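/- Let $\Omega\subset\mathbb R^3$ be a bounded open set whose boundary $\Gamma=\partial\Omega$ is a smooth closed surface with $\Omega$ locally on one side of it, and let $\mathcal D\supseteq\Omega$ be open (the hold-all). Let $n$ be the outer unit normal of $\Gamma$, $D_\Gamma n$ its derivative along $\Gamma$ (extended by zero to normal vectors), and let the principal curvatures $k_1,k_2$ be the eigenvalues of the shape operator, i.e. of $D_\Gamma n$ as an endomorphism of the tangent plane. The total variation of the normal is $$J(\Omega)=|n|_{TV(\Gamma)}=\int_\Gamma g\,ds,\qquad g=\big(|(D_\Gamma n)\,\xi_1|^2+|(D_\Gamma n)\,\xi_2|^2\big)^{1/2},$$ where $\{\xi_1,\xi_2\}$ is an orthonormal basis of the tangent plane (the choice does not matter). For a smooth vector field $V$ with compact support in $\mathcal D$ put $T_\varepsilon(x)=x+\varepsilon V(x)$, $\Omega_\varepsilon=T_\varepsilon(\Omega)$, $\Gamma_\varepsilon=\partial\Omega_\varepsilon$, $s_\varepsilon=T_\varepsilon(s)$; let $n_\varepsilon$ and $g(\varepsilon,\cdot)$ be the outer unit normal and the integrand on $\Gamma_\varepsilon$. For $s\in\Gamma$ and an orthonormal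 basis $\xi_1,\xi_2$ of the tangent plane at $s$, let $\xi_{1,\varepsilon},\xi_{2,\varepsilon}$ be the orthonormal basis of the tangent plane of $\Gamma_\varepsilon$ at $s_\varepsilon$ that the Gram--Schmidt process produces from $DT_\varepsilon(s)\xi_1,\,DT_\varepsilon(s)\xi_2$. The material derivatives at $s$ are $$dg[V](s)=\tfrac{d}{d\varepsilon}\Big|_{\varepsilon=0}g(\varepsilon,s_\varepsilon),\qquad d[(D_\Gamma n)\,\xi_i][V](s)=\tfrac{d}{d\varepsilon}\Big|_{\varepsilon=0}\big(D_{\Gamma_\varepsilon}n_\varepsilon\big)(s_\varepsilon)\,\xi_{i,\varepsilon}.$$ **Theorem.** Suppose that the set of points of $\Gamma$ at which $k_1=k_2=0$ has surface measure zero. Then $J$ is shape differentiable at $\Omega$: for every smooth vector field $V$ with compact support in $\mathcal D$ the limit $$dJ(\Omega)[V]=\lim_{\varepsilon\searrow0}\frac{J(\Omega_\varepsilon)-J(\Omega)}{\varepsilon}$$ exists, and it is linear and continuous in $V$ (with respect to the usual topology of $C_c^\infty(\mathcal D,\mathbb R^3)$). Moreover, for every such $V$: 1. $g(\varepsilon,\cdot)\in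 L^1(\Gamma_\varepsilon)$ for all $\varepsilon$ sufficiently close to $0$. 2. At every $s\in\Gamma$ at which $k_1,k_2$ do not both vanish, and for every orthonormal basis $\xi_1,\xi_2$ of the tangent plane at $s$, the material derivatives $d[(D_\Gamma n)\,\xi_i][V]$ and $dg[V]$ exist and $$dg[V]=\frac1{g}\sum_{i=1}^2\big\langle (D_\Gamma n)\,\xi_i,\; d[(D_\Gamma n)\,\xi_i][V]\big\rangle .$$ 3. $dg[V]$, which by 2. is defined almost everywhere, belongs to $L^1(\Gamma)$, and, with $\operatorname{div}_\Gamma V=\sum_{i=1}^2\xi_i^\top (DV)\,\xi_i$, $$dJ(\Omega)[V]=\int_\Gamma \big(g\,\operatorname{div}_\Gamma V+dg[V]\big)\,ds .$$ -/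

import Mathlib

open Filter Topology MeasureTheory TopologicalSpace
open scoped RealInnerProductSpace ContDiff Distributions

noncomputable section

namespace ShapeTV

/-- Euclidean three-space. -/
abbrev E3 : Type := EuclideanSpace ℝ (Fin 3)

/-- The set `Ω` has a smooth boundary (and lies locally on one side of it): near each boundary point
it is the sublevel set `{φ < 0}` of a smooth function with nonvanishing gradient at that point. Near
that point `∂Ω` is then the smooth embedded surface `{φ = 0}`. -/
def HasSmoothBoundary (Ω : Set E3) : Prop :=
  ∀ x ∈ frontier Ω, ∃ φ : E3 → ℝ, ContDiff ℝ ∞ φ ∧ φ x = 0 ∧ fderiv ℝ φ x ≠ 0 ∧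
    ∀ᶠ y in 𝓝 x, (y ∈ Ω ↔ φ y < 0)

/-- The tangent plane of `Γ` at `s`, as a linear subspace of Euclidean space. -/
def tangentPlane (Γ : Set E3) (s : E3) : Submodule ℝ E3 :=
  Submodule.span ℝ (tangentConeAt ℝ Γ s)

/-- `ν` is an outward pointing unit normal vector of `∂Ω` at `s`. -/
def IsOuterUnitNormal (Ω : Set E3) (s ν : E3) : Prop :=
  ‖ν‖ = 1 ∧ (∀ ξ ∈ tangentPlane (frontier Ω) s, ⟪ξ, ν⟫ = 0) ∧
    ∀ᶠ t in 𝓝[>] (0 : ℝ), s + t • ν ∉ Ω ∧ s - t • ν ∈ Ω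

open Classical in
/-- The outer unit normal field of `∂Ω` (zero where no outer unit normal exists). -/
def outerNormal (Ω : Set E3) (s : E3) : E3 :=
  if h : ∃ ν, IsOuterUnitNormal Ω s ν then h.choose else 0

/-- The derivative `D_Γ n` of the outer unit normal along `Γ = ∂Ω`. The derivative of `n` within `Γ`
is determined on tangent vectors of `Γ` only; it is extended by zero to normal vectors, as if `n`
were extended constantly in normal direction. -/
def normalDeriv (Ω : Set E3) (s : E3) : E3 →L[ℝ] E3 :=
  (fderivWithin ℝ (outerNormal Ω) (frontier Ω) s).comp
    (tangentPlane (frontier Ω) s).starProjection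

/-- The shape operator of `∂Ω` at `s`, the derivative of the Gauss map regarded as an endomorphism
of the tangent plane. (The values of `D_Γ n` are tangential, so the projection in the last step only
serves to change the codomain.) -/
def shapeOperator (Ω : Set E3) (s : E3) :
    tangentPlane (frontier Ω) s →ₗ[ℝ] tangentPlane (frontier Ω) s :=
  ((tangentPlane (frontier Ω) s).orthogonalProjectionOnto.comp
    ((normalDeriv Ω s).comp (tangentPlane (frontier Ω) s).subtypeL)).toLinearMap

/-- `k` is a principal curvature of `∂Ω` at `s`. -/
def IsPrincipalCurvature (Ω : Set E3) (s : E3) (k : ℝ) : Prop :=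
  Module.End.HasEigenvalue (shapeOperator Ω s) k

/-- The integrand `(|(D_Γ n) ξ₁|² + |(D_Γ n) ξ₂|²)^(1/2)` of the total variation of the normal, for an
orthonormal basis of the tangent plane (it does not depend on the basis). -/
def tvIntegrand (Ω : Set E3) (s : E3) : ℝ :=
  Real.sqrt (∑ i, ‖normalDeriv Ω s (stdOrthonormalBasis ℝ (tangentPlane (frontier Ω) s) i : E3)‖ ^ 2)

/-- The total variation of the normal `∫_Γ (|(D_Γ n) ξ₁|² + |(D_Γ n) ξ₂|²)^(1/2) ds`, `Γ = ∂Ω`, with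
respect to the surface measure. -/
def totalVariationNormal (Ω : Set E3) : ℝ :=
  ∫ s in frontier Ω, tvIntegrand Ω s ∂μHE[2]

/-- The perturbation of identity `T_ε(x) = x + ε V(x)`. -/
def perturb (V : E3 → E3) (ε : ℝ) (x : E3) : E3 := x + ε • V x

/-- The perturbed domain `Ω_ε = T_ε(Ω)`. -/
def perturbedDomain (V : E3 → E3) (Ω : Set E3) (ε : ℝ) : Set E3 := perturb V ε '' Ω

/-- `J` has the directional shape derivative (Eulerian derivative) `l` at `Ω` in the direction `V`. -/
def HasShapeDeriv (J : Set E3 → ℝ) (Ω : Set E3) (V : E3 → E3) (l : ℝ) : Prop :=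
  Tendsto (fun ε : ℝ => (J (perturbedDomain V Ω ε) - J Ω) / ε) (𝓝[>] 0) (𝓝 l)

/-- `J` is shape differentiable at `Ω` with hold-all `D`: the directional shape derivative exists in
the direction of every smooth vector field with compact support in `D`, and it depends linearly and
continuously on the vector field. -/
def ShapeDifferentiable (J : Set E3 → ℝ) (D : Opens E3) (Ω : Set E3) : Prop :=
  ∃ L : 𝓓(D, E3) →L[ℝ] ℝ, ∀ V : 𝓓(D, E3), HasShapeDeriv J Ω V (L V)

/-- The material derivative `d/dε g(ε, T_ε(s))` at `ε = 0` of a quantity `g` that is defined along the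
boundaries of domains. -/
def materialDeriv (g : Set E3 → E3 → ℝ) (Ω : Set E3) (V : E3 → E3) (s : E3) : ℝ :=
  deriv (fun ε : ℝ => g (perturbedDomain V Ω ε) (perturb V ε s)) 0

/-- The quantity `g`, defined along the boundaries of domains, has the material derivative `l`. -/
def HasMaterialDeriv (g : Set E3 → E3 → ℝ) (Ω : Set E3) (V : E3 → E3) (s : E3) (l : ℝ) : Prop :=
  HasDerivAt (fun ε : ℝ => g (perturbedDomain V Ω ε) (perturb V ε s)) l 0

/-- The tangential divergence `∑ᵢ ξᵢᵀ (DV) ξᵢ` of `V` along `Γ`. -/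
def tangentialDiv (Γ : Set E3) (V : E3 → E3) (s : E3) : ℝ :=
  ∑ i, ⟪(stdOrthonormalBasis ℝ (tangentPlane Γ s) i : E3),
    fderiv ℝ V s (stdOrthonormalBasis ℝ (tangentPlane Γ s) i : E3)⟫

/-- The first vector of the perturbed tangent basis at `T_ε(s)`: `(DT_ε) ξ₁`, normalized. -/
def perturbedFrame₁ (V : E3 → E3) (s ξ₁ : E3) (ε : ℝ) : E3 :=
  ‖fderiv ℝ (perturb V ε) s ξ₁‖⁻¹ • fderiv ℝ (perturb V ε) s ξ₁

/-- The second vector of the perturbed tangent basis at `T_ε(s)`: `(DT_ε) ξ₂`, orthonormalized with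
respect to the first vector (Gram--Schmidt). -/
def perturbedFrame₂ (V : E3 → E3) (s ξ₁ ξ₂ : E3) (ε : ℝ) : E3 :=
  let u := perturbedFrame₁ V s ξ₁ ε
  let w := fderiv ℝ (perturb V ε) s ξ₂ - ⟪u, fderiv ℝ (perturb V ε) s ξ₂⟫ • u
  ‖w‖⁻¹ • w

/-- The perturbed orthonormal tangent basis `(ξ_{1,ε}, ξ_{2,ε})` at `T_ε(s)`. -/
def perturbedFrame (V : E3 → E3) (s : E3) (ξ : Fin 2 → E3) (ε : ℝ) : Fin 2 → E3 :=
  ![perturbedFrame₁ V s (ξ 0) ε, perturbedFrame₂ V s (ξ 0) (ξ 1) ε]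

/-- `l` is the material derivative `d[(D_Γ n) ξᵢ][V]` at `s`, where the tangent basis `ξ` at `s` is
carried along by the perturbation. -/
def HasMaterialDerivNormalFrame (Ω : Set E3) (V : E3 → E3) (s : E3) (ξ : Fin 2 → E3) (i : Fin 2)
    (l : E3) : Prop :=
  HasDerivAt (fun ε : ℝ => normalDeriv (perturbedDomain V Ω ε) (perturb V ε s)
    (perturbedFrame V s ξ ε i)) l 0

end ShapeTV

end

open ShapeTV

noncomputable section

namespace ShapeTV

/-! For small `ε` the map `T_ε` is a diffeomorphism, so `J(Ω_ε)` can be pulled back to an integral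
over the fixed surface `Γ`. The unit normal of the image is the normalized covector `n ∘ DT_ε⁻¹`,
and differentiating this along `Γ` expresses `D_{Γ_ε} n_ε` at `T_ε(x)` through `n`, `D_Γ n`, `DT_ε`
and `D²T_ε` at `x`. Hence the pulled back integrand, Jacobian included, is `‖f(p(x), ε j(x))‖`,
where `p(x)` collects normal, derivative of the normal and a tangent frame, `j(x) = (DV(x),
D²V(x))`, and `f` is a fixed map between finite-dimensional spaces that is smooth near `j = 0`
(`tvIntegrand_perturb`, `totalVariationNormal_perturbedDomain`).

The data `p(x)` stay in a compact set, so `f(p, ·)`, and with it its norm, is Lipschitz at `0`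
uniformly in `x`. The norm is differentiable at `0` wherever `f(p, 0) ≠ 0`, that is, where `k₁, k₂`
do not both vanish, hence almost everywhere by hypothesis. At flat points only a one-sided
derivative survives, in general not linear in `V`. Dominated convergence then gives the shape
derivative as the integral of a pointwise derivative that is linear in `j(x)` and bounded by a
constant times `‖j(x)‖`; linearity and continuity in `V` follow. The derivative of the Jacobian is
the tangential divergence, so the product rule yields the stated formula.

The change of variables on `Γ` is proved without charts: `Γ` and its image are compared with planar
sets at small scales, and the Besicovitch differentiation theorem identifies the density
(`map_symm_restrict_image_eq_withDensity`). -/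

/-- The Euclidean plane. -/
abbrev E2 : Type := EuclideanSpace ℝ (Fin 2)

/-! ### Comparison of Hausdorff measures under Lipschitz relations. -/

section HausdorffComparison

variable {X Y Z : Type*} [MetricSpace X] [MeasurableSpace X] [BorelSpace X]
  [MetricSpace Y] [MeasurableSpace Y] [BorelSpace Y]

theorem euclideanHausdorffMeasure_image_le_of_lipschitzOnWith {f : X → Y} {s : Set X} {K : NNReal}
    (h : LipschitzOnWith K f s) (d : ℕ) : μHE[d] (f '' s) ≤ (K : ENNReal) ^ d * μHE[d] s := by
  have := h.hausdorffMeasure_image_le (d := d) (by positivity)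
  rw [ENNReal.rpow_natCast] at this
  simp only [Measure.euclideanHausdorffMeasure_def, Measure.smul_apply]
  calc _ ≤ _ • ((K : ENNReal) ^ d * μH[d] s) := by gcongr
    _ = _ := by rw [mul_smul_comm]

/-- The distance bound makes `f` factor through `h` on `A`, and the factor is `K`-Lipschitz. Two
images of one parameter set can thus be compared without injectivity of either map. -/
theorem euclideanHausdorffMeasure_image_le_of_dist_le {f : Z → Y} {h : Z → X} {A : Set Z}
    {K : NNReal} (H : ∀ x ∈ A, ∀ y ∈ A, dist (f x) (f y) ≤ K * dist (h x) (h y)) (d : ℕ) :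
    μHE[d] (f '' A) ≤ (K : ENNReal) ^ d * μHE[d] (h '' A) := by
  rcases A.eq_empty_or_nonempty with rfl | ⟨a, -⟩
  · simp
  have : Nonempty Z := ⟨a⟩
  have hinv : ∀ x ∈ A, Function.invFunOn h A (h x) ∈ A ∧ h (Function.invFunOn h A (h x)) = h x :=
    fun x hx => ⟨Function.invFunOn_mem ⟨x, hx, rfl⟩, Function.invFunOn_eq ⟨x, hx, rfl⟩⟩
  have himg : f '' A = (f ∘ Function.invFunOn h A) '' (h '' A) := by
    rw [Set.image_image]
    refine Set.image_congr fun x hx => ?_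
    obtain ⟨h1, h2⟩ := hinv x hx
    have := H x hx _ h1
    rw [h2, dist_self, mul_zero] at this
    exact dist_le_zero.1 this
  rw [himg]
  apply euclideanHausdorffMeasure_image_le_of_lipschitzOnWith
  apply LipschitzOnWith.of_dist_le_mul
  rintro _ ⟨x, hx, rfl⟩ _ ⟨y, hy, rfl⟩
  obtain ⟨h1, h2⟩ := hinv x hx
  obtain ⟨h3, h4⟩ := hinv y hy
  simpa [h2, h4] using H _ h1 _ h3

end HausdorffComparison

/-! ### The area formula for surfaces with strict tangent frames. -/

/-- The square root of the Gram determinant of `u, v`: the area of the parallelogram. -/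
def gramArea (u v : E3) : ℝ := Real.sqrt (‖u‖ ^ 2 * ‖v‖ ^ 2 - ⟪u, v⟫ ^ 2)

/-- `L` is a square map `K` followed by an isometric embedding of the plane, and `(det K)²` is the
Gram determinant of the columns of `K`, which have the same inner products as those of `L`. -/
theorem euclideanHausdorffMeasure_image_linear (L : E2 →L[ℝ] E3) (hL : Function.Injective L)
    (A : Set E2) : μHE[2] (L '' A) = ENNReal.ofReal
      (gramArea (L (EuclideanSpace.single 0 1)) (L (EuclideanSpace.single 1 1))) * volume A := by
  let W : Submodule ℝ E3 := LinearMap.range (L : E2 →ₗ[ℝ] E3)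
  have hW : Module.finrank ℝ W = 2 := by
    rw [LinearMap.finrank_range_of_inj hL]; simp
  let e : W ≃ₗᵢ[ℝ] E2 := ((stdOrthonormalBasis ℝ W).reindex (finCongr hW)).repr
  let K : E2 →ₗ[ℝ] E2 := e.toLinearEquiv.toLinearMap ∘ₗ LinearMap.rangeRestrict (L : E2 →ₗ[ℝ] E3)
  have hLK : ∀ a, L a = ((e.symm (K a) : W) : E3) := by
    intro a; simp [K]
  have himg : L '' A = (fun a => ((e.symm a : W) : E3)) '' (K '' A) := by
    rw [Set.image_image]; exact Set.image_congr fun a _ => hLK a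
  have hiso : Isometry (fun a => ((e.symm a : W) : E3)) :=
    isometry_subtype_coe.comp e.symm.isometry
  have hin : ∀ a c, ⟪L a, L c⟫ = ⟪K a, K c⟫ := by
    intro a c
    rw [hLK, hLK, ← Submodule.coe_inner, LinearIsometryEquiv.inner_map_map]
  have hn : ∀ a, ‖L a‖ ^ 2 = ‖K a‖ ^ 2 := by
    intro a; rw [← real_inner_self_eq_norm_sq, ← real_inner_self_eq_norm_sq, hin]
  rw [himg, hiso.euclideanHausdorffMeasure_image,
    EuclideanSpace.euclideanHausdorffMeasure_eq_volume, Measure.addHaar_image_linearMap]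
  congr 2
  rw [gramArea, hn, hn, hin, ← Real.sqrt_sq_eq_abs]
  congr 1
  let bb := (EuclideanSpace.basisFun (Fin 2) ℝ).toBasis
  rw [← LinearMap.det_toMatrix bb, Matrix.det_fin_two]
  simp only [LinearMap.toMatrix_apply, bb, OrthonormalBasis.coe_toBasis,
    EuclideanSpace.basisFun_apply, OrthonormalBasis.coe_toBasis_repr_apply,
    EuclideanSpace.basisFun_repr, EuclideanSpace.norm_sq_eq, Fin.sum_univ_two, PiLp.inner_apply,
    Real.norm_eq_abs, sq_abs, RCLike.inner_apply, conj_trivial]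
  ring

/-- The linear map `a ↦ a₀ u + a₁ v`. -/
def frameMap (u v : E3) : E2 →L[ℝ] E3 :=
  (EuclideanSpace.proj 0 : E2 →L[ℝ] ℝ).smulRight u + (EuclideanSpace.proj 1 : E2 →L[ℝ] ℝ).smulRight v

theorem frameMap_apply (u v : E3) (a : E2) : frameMap u v a = a 0 • u + a 1 • v := by
  simp [frameMap]

/-- The coordinates `(⟪u, x⟫, ⟪v, x⟫)`. -/
def frameCoord (u v : E3) (x : E3) : E2 := !₂[⟪u, x⟫, ⟪v, x⟫]

theorem frameMap_frameCoord (u v x : E3) :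
    frameMap u v (frameCoord u v x) = ⟪u, x⟫ • u + ⟪v, x⟫ • v := by
  simp [frameMap_apply, frameCoord]

theorem frameCoord_sub (u v x y : E3) :
    frameCoord u v (x - y) = frameCoord u v x - frameCoord u v y := by
  ext i; fin_cases i <;> simp [frameCoord, inner_sub_right]

theorem norm_frameMap {u v : E3} (hu : ‖u‖ = 1) (hv : ‖v‖ = 1) (huv : ⟪u, v⟫ = 0) (a : E2) :
    ‖frameMap u v a‖ = ‖a‖ := by
  rw [← sq_eq_sq₀ (norm_nonneg _) (norm_nonneg _), frameMap_apply, norm_add_sq_real,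
    EuclideanSpace.norm_sq_eq a, norm_smul, norm_smul, hu, hv, inner_smul_left, inner_smul_right,
    huv]
  simp

/-- `u, v` is an orthonormal frame of the tangent plane of `Γ` at `s`, in the strict sense that
secants of `Γ` near `s` make small angles with the plane. -/
structure IsTangentFrame (Γ : Set E3) (s u v : E3) : Prop where
  norm_left : ‖u‖ = 1
  norm_right : ‖v‖ = 1
  inner_eq : ⟪u, v⟫ = 0
  secant : ∀ η > 0, ∀ᶠ z : E3 × E3 in 𝓝 (s, s), z.1 ∈ Γ → z.2 ∈ Γ →
    ‖(z.1 - z.2) - frameMap u v (frameCoord u v (z.1 - z.2))‖ ≤ η * ‖z.1 - z.2‖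

/-- Near `s` the increments of `T` along `Γ` agree, up to a small relative error, with those of the
linear map `F ∘ frameMap u v` applied to the tangential coordinates. The measure of the linear image
is known exactly, and the Lipschitz comparison in both directions costs `κ` per dimension. -/
theorem IsTangentFrame.exists_measure_image_bounds {Γ : Set E3} {s u v : E3}
    (h : IsTangentFrame Γ s u v) {T : E3 → E3} {F : E3 →L[ℝ] E3} (hT : HasStrictFDerivAt T F s)
    (hF : Function.Injective F) {κ : NNReal} (hκ : 1 < κ) :
    ∃ U ∈ 𝓝 s, ∀ A ⊆ U ∩ Γ,
      μHE[2] (T '' A) ≤ (κ : ENNReal) ^ 2 *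
        (ENNReal.ofReal (gramArea (F u) (F v)) * volume (frameCoord u v '' A)) ∧
      ENNReal.ofReal (gramArea (F u) (F v)) * volume (frameCoord u v '' A) ≤
        (κ : ENNReal) ^ 2 * μHE[2] (T '' A) := by
  obtain ⟨c, hc0, hc⟩ : ∃ c > 0, ∀ w, c * ‖w‖ ≤ ‖F w‖ := by
    obtain ⟨K, hK0, hK⟩ := LinearMap.exists_antilipschitzWith (F : E3 →ₗ[ℝ] E3)
      (LinearMap.ker_eq_bot.2 hF)
    refine ⟨(K : ℝ)⁻¹, by positivity, fun w => ?_⟩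
    have := hK.le_mul_dist w 0
    simp only [dist_zero_right, map_zero, ContinuousLinearMap.coe_coe] at this
    rw [inv_mul_le_iff₀ (by positivity)]
    exact this
  have hκ' : (1 : ℝ) < κ := by exact_mod_cast hκ
  -- Chosen so that `(1 - δ) κ = 1` and `1 + δ ≤ κ`: a relative error `δ` costs at most a factor `κ`
  -- either way.
  set δ : ℝ := 1 - (κ : ℝ)⁻¹ with hδ
  have hδ0 : 0 < δ := by
    have := inv_lt_one_of_one_lt₀ hκ'; linarith
  -- The bound `1/2` gives `‖d‖ ≤ 2‖q‖` for a secant `d` and its projection `q`; the other bound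
  -- makes the total error `η (1 + ‖F‖) ‖d‖` at most `δ c ‖q‖ ≤ δ ‖F q‖`.
  set η : ℝ := min (1 / 2) (δ * c / (2 * (1 + ‖F‖))) with hη
  have hη0 : 0 < η := by positivity
  have hη1 : η ≤ 1 / 2 := min_le_left _ _
  have hη2 : η * (1 + ‖F‖) * 2 ≤ δ * c := by
    have : η ≤ δ * c / (2 * (1 + ‖F‖)) := min_le_right _ _
    rw [le_div_iff₀ (by positivity)] at this
    linarith
  have hev : ∀ᶠ z : E3 × E3 in 𝓝 (s, s), z.1 ∈ Γ → z.2 ∈ Γ →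
      ‖T z.1 - T z.2 - F (frameMap u v (frameCoord u v (z.1 - z.2)))‖ ≤
        δ * ‖F (frameMap u v (frameCoord u v (z.1 - z.2)))‖ := by
    filter_upwards [h.secant η hη0, hT.isLittleO.bound hη0] with z h1 h2 hz1 hz2
    specialize h1 hz1 hz2
    set d := z.1 - z.2
    set q := frameMap u v (frameCoord u v d)
    have h3 : ‖d‖ ≤ 2 * ‖q‖ := by
      have : ‖d‖ ≤ ‖d - q‖ + ‖q‖ := norm_le_norm_sub_add _ _
      nlinarith [norm_nonneg d]
    have h4 : ‖F (d - q)‖ ≤ ‖F‖ * (η * ‖d‖) :=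
      (F.le_opNorm _).trans (by gcongr)
    have h5 : ‖T z.1 - T z.2 - F q‖ ≤ ‖T z.1 - T z.2 - F d‖ + ‖F (d - q)‖ := by
      have : T z.1 - T z.2 - F q = (T z.1 - T z.2 - F d) + F (d - q) := by
        rw [map_sub F d q]; abel
      rw [this]; exact norm_add_le _ _
    calc _ ≤ η * ‖d‖ + ‖F‖ * (η * ‖d‖) := h5.trans (add_le_add h2 h4)
      _ = η * (1 + ‖F‖) * ‖d‖ := by ring
      _ ≤ η * (1 + ‖F‖) * (2 * ‖q‖) := by gcongr
      _ = (η * (1 + ‖F‖) * 2) * ‖q‖ := by ring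
      _ ≤ (δ * c) * ‖q‖ := by gcongr
      _ = δ * (c * ‖q‖) := by ring
      _ ≤ _ := by gcongr; exact hc q
  rw [nhds_prod_eq] at hev
  obtain ⟨U, hU, hUU⟩ := eventually_prod_self_iff'.1 hev
  refine ⟨U, hU, fun A hA => ?_⟩
  set L : E2 →L[ℝ] E3 := F.comp (frameMap u v) with hL
  have hLinj : Function.Injective L := by
    refine hF.comp ?_
    refine (injective_iff_map_eq_zero _).2 fun a ha => ?_
    have := norm_frameMap h.norm_left h.norm_right h.inner_eq a
    exact norm_eq_zero.1 (this.symm.trans (norm_eq_zero.2 ha))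
  have hvol : μHE[2] ((fun x => L (frameCoord u v x)) '' A) =
      ENNReal.ofReal (gramArea (F u) (F v)) * volume (frameCoord u v '' A) := by
    rw [← Set.image_image, euclideanHausdorffMeasure_image_linear L hLinj]
    simp [hL, frameMap_apply]
  have hdist : ∀ x ∈ A, ∀ y ∈ A, ‖T x - T y - (L (frameCoord u v x) - L (frameCoord u v y))‖ ≤
      δ * ‖L (frameCoord u v x) - L (frameCoord u v y)‖ := by
    intro x hx y hy
    have := hUU x (hA hx).1 y (hA hy).1 (hA hx).2 (hA hy).2
    simpa [hL, frameCoord_sub] using this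
  have hκδ : (1 - δ) * κ = 1 := by
    rw [hδ]; field_simp; ring
  have h1δ : 1 + δ ≤ κ := by
    nlinarith [sq_nonneg ((κ : ℝ) - 1)]
  rw [← hvol]
  constructor
  · apply euclideanHausdorffMeasure_image_le_of_dist_le
    intro x hx y hy
    have h1 := hdist x hx y hy
    rw [dist_eq_norm, dist_eq_norm]
    set a := T x - T y
    set b := L (frameCoord u v x) - L (frameCoord u v y)
    have : ‖a‖ ≤ ‖a - b‖ + ‖b‖ := norm_le_norm_sub_add _ _
    nlinarith [norm_nonneg b]
  · apply euclideanHausdorffMeasure_image_le_of_dist_le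
    intro x hx y hy
    have h1 := hdist x hx y hy
    rw [dist_eq_norm, dist_eq_norm]
    set a := T x - T y
    set b := L (frameCoord u v x) - L (frameCoord u v y)
    have h2 : ‖b‖ ≤ ‖b - a‖ + ‖a‖ := norm_le_norm_sub_add _ _
    rw [norm_sub_rev b a] at h2
    have h3 : (1 - δ) * ‖b‖ ≤ ‖a‖ := by linarith
    calc ‖b‖ = κ * ((1 - δ) * ‖b‖) := by rw [← mul_assoc, mul_comm (κ : ℝ), hκδ, one_mul]
      _ ≤ _ := by gcongr

theorem gramArea_of_orthonormal {u v : E3} (hu : ‖u‖ = 1) (hv : ‖v‖ = 1) (huv : ⟪u, v⟫ = 0) :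
    gramArea u v = 1 := by
  simp [gramArea, hu, hv, huv]

theorem IsTangentFrame.exists_measure_bounds {Γ : Set E3} {s u v : E3}
    (h : IsTangentFrame Γ s u v) {κ : NNReal} (hκ : 1 < κ) :
    ∃ U ∈ 𝓝 s, ∀ A ⊆ U ∩ Γ,
      μHE[2] A ≤ (κ : ENNReal) ^ 2 * volume (frameCoord u v '' A) ∧
      volume (frameCoord u v '' A) ≤ (κ : ENNReal) ^ 2 * μHE[2] A := by
  simpa [gramArea_of_orthonormal h.norm_left h.norm_right h.inner_eq] using
    h.exists_measure_image_bounds (hasStrictFDerivAt_id s) Function.injective_id hκ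

/-- `Γ` has tangent frames in the strict sense at all of its points. -/
def HasTangentFrames (Γ : Set E3) : Prop := ∀ s ∈ Γ, ∃ u v, IsTangentFrame Γ s u v

theorem HasTangentFrames.measure_lt_top {Γ : Set E3} (h : HasTangentFrames Γ) (hΓ : IsCompact Γ) :
    μHE[2] Γ < ⊤ := by
  apply hΓ.measure_lt_top_of_nhdsWithin
  intro s hs
  obtain ⟨u, v, huv⟩ := h s hs
  obtain ⟨U, hU, hUA⟩ := huv.exists_measure_bounds (κ := 2) (by norm_num)
  refine ⟨U ∩ Γ, inter_mem (mem_nhdsWithin_of_mem_nhds hU) self_mem_nhdsWithin, ?_⟩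
  refine (hUA _ subset_rfl).1.trans_lt ?_
  apply ENNReal.mul_lt_top (by finiteness)
  have hcont : Continuous (frameCoord u v) := by
    unfold frameCoord; fun_prop
  exact (measure_mono (Set.image_mono Set.inter_subset_right)).trans_lt
    (hΓ.image hcont).measure_lt_top

/-- The area formula for a compact surface and a Lipschitz diffeomorphism of the ambient space. -/
theorem map_symm_restrict_image_eq_withDensity {Γ : Set E3} (hΓ : IsCompact Γ)
    (T : E3 ≃ₜ E3) {K : NNReal} (hTK : LipschitzWith K T) {F : E3 → E3 →L[ℝ] E3}
    (hT : ∀ s ∈ Γ, HasStrictFDerivAt T (F s) s) (hF : ∀ s ∈ Γ, Function.Injective (F s))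
    {u v : E3 → E3} (huv : ∀ s ∈ Γ, IsTangentFrame Γ s (u s) (v s)) :
    AEMeasurable (fun s => ENNReal.ofReal (gramArea (F s (u s)) (F s (v s)))) (μHE[2].restrict Γ) ∧
    (μHE[2].restrict (T '' Γ)).map T.symm = (μHE[2].restrict Γ).withDensity
      (fun s => ENNReal.ofReal (gramArea (F s (u s)) (F s (v s)))) := by
  have hfr : HasTangentFrames Γ := fun s hs => ⟨_, _, huv s hs⟩
  have hΓm : MeasurableSet Γ := hΓ.isClosed.measurableSet
  have hTΓm : MeasurableSet (T '' Γ) := (hΓ.image T.continuous).isClosed.measurableSet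
  have hle : ∀ A : Set E3, μHE[2] (T '' A) ≤ (K : ENNReal) ^ 2 * μHE[2] A := fun A =>
    euclideanHausdorffMeasure_image_le_of_lipschitzOnWith (hTK.lipschitzOnWith) 2
  set μ : Measure E3 := μHE[2].restrict Γ with hμ
  set ν : Measure E3 := (μHE[2].restrict (T '' Γ)).map T.symm with hν
  have hμA : ∀ A, MeasurableSet A → μ A = μHE[2] (A ∩ Γ) := fun A hA => by
    rw [hμ, Measure.restrict_apply hA]
  have hνA : ∀ A, MeasurableSet A → ν A = μHE[2] (T '' (A ∩ Γ)) := fun A hA => by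
    rw [hν, Measure.map_apply T.symm.continuous.measurable hA,
      Measure.restrict_apply (T.symm.continuous.measurable hA), Set.image_inter T.injective]
    congr 2
    exact (T.image_eq_preimage_symm A).symm
  have hμfin : IsFiniteMeasure μ := ⟨by
    rw [hμA _ MeasurableSet.univ, Set.univ_inter]; exact hfr.measure_lt_top hΓ⟩
  have hνfin : IsFiniteMeasure ν := ⟨by
    rw [hνA _ MeasurableSet.univ, Set.univ_inter]
    exact (hle Γ).trans_lt (ENNReal.mul_lt_top (by finiteness) (hfr.measure_lt_top hΓ))⟩
  have hac : ν ≪ μ := by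
    refine Measure.AbsolutelyContinuous.mk fun A hA h0 => ?_
    rw [hμA A hA] at h0
    rw [hνA A hA]
    exact le_antisymm ((hle _).trans (by simp [h0])) (zero_le)
  -- Almost everywhere the density is the limit of `ν/μ` on shrinking balls. Both measures of a
  -- small ball are compared with the same planar area `w`, which cancels.
  have hkey : ν.rnDeriv μ =ᵐ[μ] fun s => ENNReal.ofReal (gramArea (F s (u s)) (F s (v s))) := by
    have h1 := (Besicovitch.vitaliFamily μ).ae_eventually_measure_pos
    have h2 := Besicovitch.ae_tendsto_rnDeriv ν μ
    have h3 : ∀ᵐ s ∂μ, s ∈ Γ := ae_restrict_mem hΓm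
    filter_upwards [h1, h2, h3] with s h1 h2 hs
    replace h1 := (Besicovitch.tendsto_filterAt μ s).eventually h1
    set J := ENNReal.ofReal (gramArea (F s (u s)) (F s (v s))) with hJ
    -- The power is `4` because the comparisons of `ν` with `J w` and of `w` with `μ` contribute
    -- `κ²` each.
    have hbounds : ∀ κ : NNReal, 1 < κ →
        ν.rnDeriv μ s ≤ (κ : ENNReal) ^ 4 * J ∧ J ≤ (κ : ENNReal) ^ 4 * ν.rnDeriv μ s := by
      intro κ hκ
      obtain ⟨U, hU, hUA⟩ := (huv s hs).exists_measure_image_bounds (hT s hs) (hF s hs) hκ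
      obtain ⟨U', hU', hUA'⟩ := (huv s hs).exists_measure_bounds hκ
      obtain ⟨r, hr, hrU⟩ := Metric.mem_nhds_iff.1 (inter_mem hU hU')
      have hev : ∀ᶠ t in 𝓝[>] (0 : ℝ),
          ν (Metric.closedBall s t) / μ (Metric.closedBall s t) ≤ (κ : ENNReal) ^ 4 * J ∧
          J ≤ (κ : ENNReal) ^ 4 *
            (ν (Metric.closedBall s t) / μ (Metric.closedBall s t)) := by
        filter_upwards [h1, Ioo_mem_nhdsGT hr] with t ht htr
        have hsub : Metric.closedBall s t ⊆ U ∩ U' :=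
          (Metric.closedBall_subset_ball htr.2).trans hrU
        obtain ⟨a1, a2⟩ := hUA (Metric.closedBall s t ∩ Γ)
          (Set.inter_subset_inter_left _ (hsub.trans Set.inter_subset_left))
        obtain ⟨b1, b2⟩ := hUA' (Metric.closedBall s t ∩ Γ)
          (Set.inter_subset_inter_left _ (hsub.trans Set.inter_subset_right))
        rw [← hνA _ Metric.isClosed_closedBall.measurableSet, ← hJ] at a1 a2
        rw [← hμA _ Metric.isClosed_closedBall.measurableSet] at b1 b2
        set m := μ (Metric.closedBall s t)
        set n := ν (Metric.closedBall s t)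
        set w := volume (frameCoord (u s) (v s) '' (Metric.closedBall s t ∩ Γ))
        have hm0 : m ≠ 0 := ht.ne'
        have hmt : m ≠ ⊤ := measure_ne_top _ _
        constructor
        · rw [ENNReal.div_le_iff hm0 hmt]
          calc n ≤ (κ : ENNReal) ^ 2 * (J * ((κ : ENNReal) ^ 2 * m)) := a1.trans (by gcongr)
            _ = _ := by ring
        · rw [← mul_div_assoc, ENNReal.le_div_iff_mul_le (Or.inl hm0) (Or.inl hmt)]
          calc J * m ≤ J * ((κ : ENNReal) ^ 2 * w) := by gcongr
            _ = (κ : ENNReal) ^ 2 * (J * w) := by ring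
            _ ≤ (κ : ENNReal) ^ 2 * ((κ : ENNReal) ^ 2 * n) := by gcongr
            _ = _ := by ring
      refine ⟨le_of_tendsto h2 (hev.mono fun t ht => ht.1),
        ge_of_tendsto (ENNReal.Tendsto.const_mul h2 (Or.inr (by finiteness)))
          (hev.mono fun t ht => ht.2)⟩
    have hlim : ∀ c : ENNReal, Tendsto (fun κ : NNReal => (κ : ENNReal) ^ 4 * c) (𝓝[>] 1) (𝓝 c) := by
      intro c
      have h4 : Tendsto (fun κ : NNReal => (κ : ENNReal) ^ 4) (𝓝[>] 1) (𝓝 1) := by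
        have : Continuous fun κ : NNReal => (κ : ENNReal) ^ 4 := by
          have : (fun κ : NNReal => (κ : ENNReal) ^ 4) = fun κ => ((κ ^ 4 : NNReal) : ENNReal) := by
            ext κ; simp
          rw [this]; exact ENNReal.continuous_coe.comp (by fun_prop)
        have h := this.tendsto 1
        simp only [ENNReal.coe_one, one_pow] at h
        exact h.mono_left nhdsWithin_le_nhds
      simpa using ENNReal.Tendsto.mul_const h4 (Or.inl one_ne_zero)
    apply le_antisymm
    · exact ge_of_tendsto (hlim J) (eventually_nhdsWithin_of_forall fun κ hκ => (hbounds κ hκ).1)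
    · exact ge_of_tendsto (hlim _) (eventually_nhdsWithin_of_forall fun κ hκ => (hbounds κ hκ).2)
  -- The frame `u, v` is not assumed measurable; the Jacobian is a.e. measurable because it agrees
  -- with a Radon–Nikodym derivative.
  refine ⟨⟨_, Measure.measurable_rnDeriv ν μ, hkey.symm⟩, ?_⟩
  have hdec : ν.HaveLebesgueDecomposition μ := Measure.haveLebesgueDecomposition_of_sigmaFinite ν μ
  exact (Measure.withDensity_rnDeriv_eq ν μ hac).symm.trans (withDensity_congr_ae hkey)

/-- Change of variables for surface integrals. -/
theorem setIntegral_image_eq {Γ : Set E3} (hΓ : IsCompact Γ)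
    (T : E3 ≃ₜ E3) {K : NNReal} (hTK : LipschitzWith K T) {F : E3 → E3 →L[ℝ] E3}
    (hT : ∀ s ∈ Γ, HasStrictFDerivAt T (F s) s) (hF : ∀ s ∈ Γ, Function.Injective (F s))
    {u v : E3 → E3} (huv : ∀ s ∈ Γ, IsTangentFrame Γ s (u s) (v s)) (g : E3 → ℝ) :
    AEMeasurable (fun s => gramArea (F s (u s)) (F s (v s))) (μHE[2].restrict Γ) ∧
    ∫ y in T '' Γ, g y ∂μHE[2] =
      ∫ s in Γ, gramArea (F s (u s)) (F s (v s)) * g (T s) ∂μHE[2] := by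
  obtain ⟨hm, heq⟩ := map_symm_restrict_image_eq_withDensity hΓ T hTK hT hF huv
  have hnn : ∀ s, 0 ≤ gramArea (F s (u s)) (F s (v s)) := fun s => Real.sqrt_nonneg _
  constructor
  · simpa [ENNReal.toReal_ofReal, hnn] using hm.ennreal_toReal
  · calc ∫ y in T '' Γ, g y ∂μHE[2]
        = ∫ y in T '' Γ, (g ∘ T) (T.symm y) ∂μHE[2] := by simp
      _ = ∫ s, (g ∘ T) s ∂((μHE[2].restrict (T '' Γ)).map T.symm) :=
          (T.symm.measurableEmbedding.integral_map (g ∘ T)).symm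
      _ = _ := by
          rw [heq, integral_withDensity_eq_integral_toReal_smul₀ hm (by simp)]
          simp [ENNReal.toReal_ofReal, hnn]

/-! ### Local defining functions: frontier, tangent plane and outer normal. -/

/-- The standard orthonormal basis of Euclidean three-space. -/
abbrev stdB : OrthonormalBasis (Fin 3) ℝ E3 := EuclideanSpace.basisFun (Fin 3) ℝ

/-- The Riesz representative of a linear functional. -/
def riesz (l : E3 →L[ℝ] ℝ) : E3 := ∑ i, l (stdB i) • stdB i

theorem inner_riesz (l : E3 →L[ℝ] ℝ) (v : E3) : ⟪riesz l, v⟫ = l v := by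
  conv_rhs => rw [← stdB.sum_repr' v]
  simp only [riesz, sum_inner, map_sum, map_smul, inner_smul_left, smul_eq_mul, conj_trivial]
  exact Finset.sum_congr rfl fun i _ => mul_comm _ _

theorem contDiff_riesz {n : WithTop ℕ∞} : ContDiff ℝ n riesz := by
  unfold riesz; fun_prop

theorem riesz_ne_zero {l : E3 →L[ℝ] ℝ} (h : l ≠ 0) : riesz l ≠ 0 := fun h0 =>
  h (ContinuousLinearMap.ext fun v => by rw [← inner_riesz, h0, inner_zero_left]; rfl)

/-- The vector `x / ‖x‖`. -/
def unitVec (x : E3) : E3 := ‖x‖⁻¹ • x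

theorem norm_unitVec {x : E3} (hx : x ≠ 0) : ‖unitVec x‖ = 1 := by
  simp [unitVec, norm_smul, hx]

theorem contDiffAt_unitVec {n : WithTop ℕ∞} {x : E3} (hx : x ≠ 0) : ContDiffAt ℝ n unitVec x :=
  ((contDiffAt_norm ℝ hx).inv (norm_ne_zero_iff.2 hx)).smul contDiffAt_id

theorem unitVec_smul {c : ℝ} (hc : 0 < c) (x : E3) : unitVec (c • x) = unitVec x := by
  simp only [unitVec, norm_smul, smul_smul, Real.norm_eq_abs, abs_of_pos hc]
  congr 1; field_simp

theorem inner_unitVec_eq_zero {x : E3} (hx : x ≠ 0) (v : E3) : ⟪unitVec x, v⟫ = 0 ↔ ⟪x, v⟫ = 0 := by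
  simp [unitVec, inner_smul_left, hx]

theorem eventually_pos_of_hasDerivAt_pos {f : ℝ → ℝ} {f' : ℝ} (hf : HasDerivAt f f' 0)
    (h0 : f 0 = 0) (hf' : 0 < f') : ∀ᶠ t in 𝓝[>] (0 : ℝ), 0 < f t := by
  have h := (hasDerivAt_iff_tendsto_slope.1 hf).mono_left
    (nhdsWithin_mono (0 : ℝ) (fun x (hx : 0 < x) => hx.ne'))
  filter_upwards [h.eventually_const_lt hf', self_mem_nhdsWithin] with t ht ht0
  simp only [slope, sub_zero, h0, smul_eq_mul, vsub_eq_sub] at ht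
  exact pos_of_mul_pos_right ht (inv_nonneg.2 (le_of_lt ht0))

/-- `φ` is a smooth local defining function of `Ω` at the boundary point `s`. -/
structure IsLocalDefiningFunction (Ω : Set E3) (s : E3) (φ : E3 → ℝ) : Prop where
  contDiff : ContDiff ℝ ∞ φ
  eq_zero : φ s = 0
  fderiv_ne : fderiv ℝ φ s ≠ 0
  mem_iff : ∀ᶠ y in 𝓝 s, (y ∈ Ω ↔ φ y < 0)

namespace IsLocalDefiningFunction

variable {Ω : Set E3} {s : E3} {φ : E3 → ℝ}

theorem continuous_fderiv (h : IsLocalDefiningFunction Ω s φ) : Continuous (fderiv ℝ φ) :=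
  h.contDiff.continuous_fderiv (by simp)

theorem hasStrictFDerivAt (h : IsLocalDefiningFunction Ω s φ) (y : E3) :
    HasStrictFDerivAt φ (fderiv ℝ φ y) y :=
  h.contDiff.contDiffAt.hasStrictFDerivAt (by simp)

/-- Where `φ > 0` there are no nearby points of `Ω`. A zero of `φ` outside the closure of `Ω` would
be a local minimum, contradicting the nonvanishing gradient. -/
theorem eventually (h : IsLocalDefiningFunction Ω s φ) (hΩ : IsOpen Ω) :
    ∀ᶠ y in 𝓝 s, (y ∈ frontier Ω ↔ φ y = 0) ∧ (φ y = 0 → IsLocalDefiningFunction Ω y φ) := by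
  filter_upwards [h.mem_iff.eventually_nhds, h.continuous_fderiv.continuousAt.eventually_ne
    h.fderiv_ne] with y hy hne
  refine ⟨?_, fun h0 => ⟨h.contDiff, h0, hne, hy⟩⟩
  have hcont := h.contDiff.continuous.continuousAt (x := y)
  rw [hΩ.frontier_eq, Set.mem_sdiff, mem_closure_iff_frequently, hy.self_of_nhds, not_lt]
  constructor
  · rintro ⟨h1, h2⟩
    refine le_antisymm (not_lt.1 fun h3 => h1 ?_) h2
    filter_upwards [hy, hcont.eventually_const_lt h3] with z hz hz'
    rw [hz]; exact not_lt.2 hz'.le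
  · intro h0
    refine ⟨fun hn => hne ?_, h0.ge⟩
    apply IsLocalMin.fderiv_eq_zero
    filter_upwards [hn, hy] with z hz hz'
    rw [h0]
    rw [hz'] at hz
    exact not_lt.1 hz

theorem mem_frontier (h : IsLocalDefiningFunction Ω s φ) (hΩ : IsOpen Ω) : s ∈ frontier Ω :=
  (h.eventually hΩ).self_of_nhds.1.2 h.eq_zero

theorem eventually_of_mem (h : IsLocalDefiningFunction Ω s φ) (hΩ : IsOpen Ω) :
    ∀ᶠ y in 𝓝[frontier Ω] s, IsLocalDefiningFunction Ω y φ := by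
  filter_upwards [nhdsWithin_le_nhds (h.eventually hΩ), self_mem_nhdsWithin] with y hy hy'
  exact hy.2 (hy.1.1 hy')

/-- Since `φ` vanishes on the frontier, its derivative must agree with `0` on the tangent cone.
Conversely, the implicit function theorem gives a curve in `{φ = 0}` through `s` with any prescribed
velocity in the kernel. -/
theorem mem_tangentPlane_iff (h : IsLocalDefiningFunction Ω s φ) (hΩ : IsOpen Ω) (v : E3) :
    v ∈ tangentPlane (frontier Ω) s ↔ fderiv ℝ φ s v = 0 := by
  constructor
  · suffices tangentPlane (frontier Ω) s ≤ LinearMap.ker (fderiv ℝ φ s : E3 →ₗ[ℝ] ℝ) from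
      fun hv => this hv
    refine Submodule.span_le.2 fun w hw => ?_
    have h1 : HasFDerivWithinAt φ (fderiv ℝ φ s) (frontier Ω) s :=
      (h.hasStrictFDerivAt s).hasFDerivAt.hasFDerivWithinAt
    have h2 : HasFDerivWithinAt φ (0 : E3 →L[ℝ] ℝ) (frontier Ω) s :=
      (hasFDerivWithinAt_const (0 : ℝ) s (frontier Ω)).congr_of_eventuallyEq
        (by filter_upwards [h.eventually_of_mem hΩ] with y hy using hy.eq_zero) h.eq_zero
    exact h1.unique_on h2 hw
  · intro hv
    apply Submodule.subset_span
    have hsurj : (fderiv ℝ φ s).range = ⊤ :=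
      LinearMap.range_eq_top.2 (LinearMap.surjective (fun h0 => h.fderiv_ne
        (ContinuousLinearMap.coe_injective h0)))
    have hst := h.hasStrictFDerivAt s
    let k : (fderiv ℝ φ s).ker := ⟨v, hv⟩
    let γ : ℝ → E3 := fun t => hst.implicitFunction φ _ hsurj (φ s) (t • k)
    have hγ0 : γ 0 = s := by simp [γ]
    have hγ : HasDerivAt γ v 0 := by
      have h1 := (hst.to_implicitFunction hsurj).hasFDerivAt
      have h2 : HasDerivAt (fun t : ℝ => t • k) k 0 := by
        simpa using (hasDerivAt_id (0 : ℝ)).smul_const k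
      rw [show (0 : (fderiv ℝ φ s).ker) = (0 : ℝ) • k by simp] at h1
      exact h1.comp_hasDerivAt (0 : ℝ) h2
    have hγφ : ∀ᶠ t in 𝓝 (0 : ℝ), φ (γ t) = 0 := by
      have h1 : Tendsto (fun t : ℝ => (φ s, t • k)) (𝓝 0) (𝓝 (φ s, 0)) := by
        have : Continuous (fun t : ℝ => (φ s, t • k)) := by fun_prop
        simpa using this.tendsto 0
      filter_upwards [h1.eventually (hst.map_implicitFunction_eq hsurj)] with t ht
      rw [← h.eq_zero]; exact ht
    have hγs : Tendsto γ (𝓝 0) (𝓝 s) := by simpa [hγ0] using hγ.continuousAt.tendsto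
    refine mem_tangentConeAt_of_seq (𝓝[≠] (0 : ℝ)) (fun t => t⁻¹) (fun t => γ t - s) ?_ ?_ ?_
    · simpa using (hγs.mono_left nhdsWithin_le_nhds).sub_const s
    · refine nhdsWithin_le_nhds ?_
      filter_upwards [hγφ, hγs.eventually (h.eventually hΩ)] with t h1 h2
      rw [add_sub_cancel]; exact h2.1.2 h1
    · have := hasDerivAt_iff_tendsto_slope.1 hγ
      refine this.congr fun t => ?_
      simp [slope, hγ0]

/-- Orthogonality to the tangent plane leaves only `±e`, with `e` the normalized gradient. The sign
is decided by `φ`, which is positive on the side towards which `e` points. -/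
theorem isOuterUnitNormal_iff (h : IsLocalDefiningFunction Ω s φ) (hΩ : IsOpen Ω) (ν : E3) :
    IsOuterUnitNormal Ω s ν ↔ ν = unitVec (riesz (fderiv ℝ φ s)) := by
  set g := riesz (fderiv ℝ φ s) with hg
  have hg0 : g ≠ 0 := riesz_ne_zero h.fderiv_ne
  set e := unitVec g with he
  have he1 : ‖e‖ = 1 := norm_unitVec hg0
  have htp : ∀ v, v ∈ tangentPlane (frontier Ω) s ↔ ⟪e, v⟫ = 0 := fun v => by
    rw [h.mem_tangentPlane_iff hΩ, inner_unitVec_eq_zero hg0, inner_riesz]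
  have hpos : 0 < fderiv ℝ φ s e := by
    rw [← inner_riesz, ← hg, he, unitVec, inner_smul_right, real_inner_self_eq_norm_sq]
    positivity
  have hderiv : ∀ w : E3, HasDerivAt (fun t : ℝ => φ (s + t • w)) (fderiv ℝ φ s w) 0 := by
    intro w
    have h2 : HasDerivAt (fun t : ℝ => s + t • w) w 0 := by
      simpa using ((hasDerivAt_id (0 : ℝ)).smul_const w).const_add s
    exact ((h.hasStrictFDerivAt s).hasFDerivAt).comp_hasDerivAt_of_eq (0 : ℝ) h2 (by simp)
  have hline : ∀ w : E3, 0 < fderiv ℝ φ s w → ∀ᶠ t in 𝓝[>] (0 : ℝ), 0 < φ (s + t • w) :=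
    fun w hw => eventually_pos_of_hasDerivAt_pos (hderiv w) (by simp [h.eq_zero]) hw
  have hneg : ∀ w : E3, fderiv ℝ φ s w < 0 → ∀ᶠ t in 𝓝[>] (0 : ℝ), φ (s + t • w) < 0 :=
    fun w hw => (eventually_pos_of_hasDerivAt_pos (hderiv w).neg (by simp [h.eq_zero])
      (neg_pos.2 hw)).mono fun t ht => neg_pos.1 ht
  have hmem : ∀ w : E3, ∀ᶠ t in 𝓝[>] (0 : ℝ), (s + t • w ∈ Ω ↔ φ (s + t • w) < 0) := by
    intro w
    have : Tendsto (fun t : ℝ => s + t • w) (𝓝[>] 0) (𝓝 s) := by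
      have : Continuous (fun t : ℝ => s + t • w) := by fun_prop
      simpa using (this.tendsto 0).mono_left nhdsWithin_le_nhds
    exact this.eventually h.mem_iff
  constructor
  · rintro ⟨h1, h2, h3⟩
    have h4 : ⟪ν - ⟪e, ν⟫ • e, ν⟫ = 0 := by
      refine h2 _ ((htp _).2 ?_)
      simp [inner_sub_right, inner_smul_right, he1]
    simp only [inner_sub_left, inner_smul_left, real_inner_self_eq_norm_sq, h1, conj_trivial] at h4
    have h5 : ν = ⟪e, ν⟫ • e := by
      rw [← sub_eq_zero, ← norm_eq_zero, ← sq_eq_zero_iff, norm_sub_sq_real, inner_smul_right,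
        norm_smul, h1, he1, real_inner_comm e ν, Real.norm_eq_abs, mul_one, sq_abs]
      linarith
    have h6 : (⟪e, ν⟫ - 1) * (⟪e, ν⟫ + 1) = 0 := by linarith
    rcases mul_eq_zero.1 h6 with h7 | h7
    · rw [h5, sub_eq_zero.1 h7, one_smul]
    · exfalso
      rw [eq_neg_of_add_eq_zero_left h7, neg_one_smul] at h5
      obtain ⟨t, ht1, ht2, ht3⟩ := (h3.and ((hmem e).and (hline e hpos))).exists
      have : s - t • ν = s + t • e := by rw [h5]; simp
      rw [this, ht2] at ht1
      exact absurd ht1.2 (not_lt.2 ht3.le)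
  · rintro rfl
    refine ⟨he1, fun v hv => by rw [real_inner_comm]; exact (htp v).1 hv, ?_⟩
    filter_upwards [hline e hpos, hmem e, hneg (-e) (by simpa using hpos), hmem (-e)]
      with t h1 h2 h3 h4
    rw [smul_neg, ← sub_eq_add_neg] at h3 h4
    exact ⟨fun h5 => absurd (h2.1 h5) (not_lt.2 h1.le), h4.2 h3⟩

theorem outerNormal_eq (h : IsLocalDefiningFunction Ω s φ) (hΩ : IsOpen Ω) :
    outerNormal Ω s = unitVec (riesz (fderiv ℝ φ s)) := by
  have hex : ∃ ν, IsOuterUnitNormal Ω s ν := ⟨_, (h.isOuterUnitNormal_iff hΩ _).2 rfl⟩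
  rw [outerNormal, dif_pos hex]
  exact (h.isOuterUnitNormal_iff hΩ _).1 hex.choose_spec

theorem contDiffAt_normal (h : IsLocalDefiningFunction Ω s φ) :
    ContDiffAt ℝ ∞ (fun y => unitVec (riesz (fderiv ℝ φ y))) s :=
  ContDiffAt.comp (g := unitVec) s (contDiffAt_unitVec (riesz_ne_zero h.fderiv_ne))
    (contDiff_riesz.comp (h.contDiff.fderiv_right (m := ∞) (by simp))).contDiffAt

theorem eventuallyEq_outerNormal (h : IsLocalDefiningFunction Ω s φ) (hΩ : IsOpen Ω) :
    outerNormal Ω =ᶠ[𝓝[frontier Ω] s] fun y => unitVec (riesz (fderiv ℝ φ y)) := by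
  filter_upwards [h.eventually_of_mem hΩ] with y hy using hy.outerNormal_eq hΩ

end IsLocalDefiningFunction

/-! ### The boundary as a surface: normal, tangent planes, strict tangent frames. -/

section Boundary

variable {Ω : Set E3} {s : E3}

theorem HasSmoothBoundary.exists_localDefiningFunction (hs : HasSmoothBoundary Ω)
    (h : s ∈ frontier Ω) : ∃ φ, IsLocalDefiningFunction Ω s φ := by
  obtain ⟨φ, h1, h2, h3, h4⟩ := hs s h
  exact ⟨φ, h1, h2, h3, h4⟩

variable (hΩ : IsOpen Ω) (hs : HasSmoothBoundary Ω) (h : s ∈ frontier Ω)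
include hΩ hs h

theorem norm_outerNormal : ‖outerNormal Ω s‖ = 1 := by
  obtain ⟨φ, hφ⟩ := hs.exists_localDefiningFunction h
  rw [hφ.outerNormal_eq hΩ, norm_unitVec (riesz_ne_zero hφ.fderiv_ne)]

theorem mem_tangentPlane_iff (v : E3) :
    v ∈ tangentPlane (frontier Ω) s ↔ ⟪outerNormal Ω s, v⟫ = 0 := by
  obtain ⟨φ, hφ⟩ := hs.exists_localDefiningFunction h
  rw [hφ.outerNormal_eq hΩ, hφ.mem_tangentPlane_iff hΩ,
    inner_unitVec_eq_zero (riesz_ne_zero hφ.fderiv_ne), inner_riesz]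

theorem tangentPlane_eq : tangentPlane (frontier Ω) s = (ℝ ∙ outerNormal Ω s)ᗮ := by
  ext v
  rw [mem_tangentPlane_iff hΩ hs h, Submodule.mem_orthogonal_singleton_iff_inner_right]

theorem finrank_tangentPlane : Module.finrank ℝ (tangentPlane (frontier Ω) s) = 2 := by
  rw [tangentPlane_eq hΩ hs h]
  have h0 : outerNormal Ω s ≠ 0 := fun h0 => by
    have := norm_outerNormal hΩ hs h
    rw [h0, norm_zero] at this; norm_num at this
  have : Fact (Module.finrank ℝ E3 = 2 + 1) := ⟨by simp⟩
  exact Submodule.finrank_orthogonal_span_singleton h0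

theorem starProjection_tangentPlane (v : E3) : (tangentPlane (frontier Ω) s).starProjection v =
    v - ⟪outerNormal Ω s, v⟫ • outerNormal Ω s := by
  have h1 := norm_outerNormal hΩ hs h
  apply Submodule.eq_starProjection_of_mem_of_inner_eq_zero
  · rw [mem_tangentPlane_iff hΩ hs h]
    simp [inner_sub_right, inner_smul_right, h1]
  · intro w hw
    rw [mem_tangentPlane_iff hΩ hs h] at hw
    simp [inner_smul_left, hw]

theorem differentiableWithinAt_outerNormal :
    DifferentiableWithinAt ℝ (outerNormal Ω) (frontier Ω) s := by
  obtain ⟨φ, hφ⟩ := hs.exists_localDefiningFunction h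
  exact ((hφ.contDiffAt_normal.differentiableAt (by simp)).differentiableWithinAt).congr_of_eventuallyEq
    (hφ.eventuallyEq_outerNormal hΩ) (hφ.outerNormal_eq hΩ)

/-- A derivative within `Γ` is unique only on the span of the tangent cone. Precomposition with the
tangential projection removes the ambiguity, so any smooth extension of the normal may be used to
compute. -/
theorem normalDeriv_apply {L : E3 →L[ℝ] E3} (hL : HasFDerivWithinAt (outerNormal Ω) L (frontier Ω) s)
    (v : E3) : normalDeriv Ω s v = L (v - ⟪outerNormal Ω s, v⟫ • outerNormal Ω s) := by
  rw [normalDeriv, ContinuousLinearMap.comp_apply, starProjection_tangentPlane hΩ hs h]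
  set w := v - ⟪outerNormal Ω s, v⟫ • outerNormal Ω s
  have hw : w ∈ tangentPlane (frontier Ω) s := by
    rw [mem_tangentPlane_iff hΩ hs h]
    simp [w, inner_sub_right, inner_smul_right, norm_outerNormal hΩ hs h]
  have hL' := (differentiableWithinAt_outerNormal hΩ hs h).hasFDerivWithinAt
  have : tangentPlane (frontier Ω) s ≤
      LinearMap.eqLocus (fderivWithin ℝ (outerNormal Ω) (frontier Ω) s : E3 →ₗ[ℝ] E3)
        (L : E3 →ₗ[ℝ] E3) :=
    Submodule.span_le.2 (hL'.unique_on hL)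
  exact this hw

/-- The normal part of a secant `d` is `⟪n, d⟫ n`, and `⟪n, d⟫` is proportional to `dφ(d)`. As `φ`
vanishes at both endpoints, strict differentiability makes this `o(‖d‖)`. -/
theorem isTangentFrame_of_orthonormal {u v : E3} (hu : ‖u‖ = 1) (hv : ‖v‖ = 1) (huv : ⟪u, v⟫ = 0)
    (hnu : ⟪outerNormal Ω s, u⟫ = 0) (hnv : ⟪outerNormal Ω s, v⟫ = 0) :
    IsTangentFrame (frontier Ω) s u v := by
  refine ⟨hu, hv, huv, fun η hη => ?_⟩
  have hn1 := norm_outerNormal hΩ hs h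
  set n := outerNormal Ω s with hn
  have hon : Orthonormal ℝ ![u, v, n] := by
    rw [orthonormal_iff_ite]
    have h1 := real_inner_self_eq_norm_sq u
    have h2 := real_inner_self_eq_norm_sq v
    have h3 := real_inner_self_eq_norm_sq n
    have h4 := real_inner_comm u v
    have h5 := real_inner_comm u n
    have h6 := real_inner_comm v n
    rw [hu] at h1; rw [hv] at h2; rw [hn1] at h3
    intro i j
    fin_cases i <;> fin_cases j <;> simp_all
  let B : OrthonormalBasis (Fin 3) ℝ E3 := OrthonormalBasis.mk hon (by
    rw [hon.linearIndependent.span_eq_top_of_card_eq_finrank' (by simp)])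
  have hB : ∀ d : E3, d - frameMap u v (frameCoord u v d) = ⟪n, d⟫ • n := by
    intro d
    have := B.sum_repr' d
    simp only [B, OrthonormalBasis.coe_mk, Fin.sum_univ_three, Matrix.cons_val_zero,
      Matrix.cons_val_one, Matrix.cons_val] at this
    rw [frameMap_frameCoord]
    nth_rewrite 1 [← this]
    abel
  obtain ⟨φ, hφ⟩ := hs.exists_localDefiningFunction h
  set g := riesz (fderiv ℝ φ s) with hg
  have hg0 : 0 < ‖g‖ := norm_pos_iff.2 (riesz_ne_zero hφ.fderiv_ne)
  have hng : ∀ d, ⟪n, d⟫ = ‖g‖⁻¹ * fderiv ℝ φ s d := fun d => by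
    rw [hn, hφ.outerNormal_eq hΩ, ← hg, unitVec, inner_smul_left, hg, inner_riesz]; simp
  have hz := (hφ.hasStrictFDerivAt s).isLittleO.bound (mul_pos hη hg0)
  have hev := hφ.eventually hΩ
  have hev1 : ∀ᶠ z : E3 × E3 in 𝓝 (s, s), z.1 ∈ frontier Ω → φ z.1 = 0 := by
    filter_upwards [(continuous_fst.tendsto (s, s)).eventually hev] with z hz1 hz2
    exact hz1.1.1 hz2
  have hev2 : ∀ᶠ z : E3 × E3 in 𝓝 (s, s), z.2 ∈ frontier Ω → φ z.2 = 0 := by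
    filter_upwards [(continuous_snd.tendsto (s, s)).eventually hev] with z hz1 hz2
    exact hz1.1.1 hz2
  filter_upwards [hz, hev1, hev2] with z hz h1 h2 hz1 hz2
  rw [h1 hz1, h2 hz2, sub_zero, zero_sub, norm_neg] at hz
  rw [hB, norm_smul, hn1, mul_one, hng, norm_mul, norm_inv, norm_norm, inv_mul_le_iff₀ hg0]
  linarith

end Boundary

/-! ### Continuity of the curvature and its Hilbert–Schmidt norm. -/

/-- One defining function serves all boundary points near `s`, so its normalized gradient `e`
extends the normal smoothly there and the derivative along `Γ` is `De ∘ (1 - e ⊗ e)`. -/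
theorem continuousOn_normalDeriv {Ω : Set E3} (hΩ : IsOpen Ω) (hs : HasSmoothBoundary Ω) :
    ContinuousOn (normalDeriv Ω) (frontier Ω) := by
  intro s h
  obtain ⟨φ, hφ⟩ := hs.exists_localDefiningFunction h
  set e : E3 → E3 := fun y => unitVec (riesz (fderiv ℝ φ y)) with he
  have hform : ∀ y, IsLocalDefiningFunction Ω y φ → normalDeriv Ω y =
      (fderiv ℝ e y).comp (ContinuousLinearMap.id ℝ E3 - (innerSL ℝ (e y)).smulRight (e y)) := by
    intro y hy
    have hL : HasFDerivWithinAt (outerNormal Ω) (fderiv ℝ e y) (frontier Ω) y :=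
      (hy.contDiffAt_normal.differentiableAt (by simp)).hasFDerivAt.hasFDerivWithinAt
        |>.congr_of_eventuallyEq (hy.eventuallyEq_outerNormal hΩ) (hy.outerNormal_eq hΩ)
    ext1 v
    rw [normalDeriv_apply hΩ hs (hy.mem_frontier hΩ) hL, hy.outerNormal_eq hΩ]
    simp [e]
  have hc : ContinuousAt (fun y => (fderiv ℝ e y).comp
      (ContinuousLinearMap.id ℝ E3 - (innerSL ℝ (e y)).smulRight (e y))) s := by
    have h1 : ContinuousAt (fderiv ℝ e) s :=
      (hφ.contDiffAt_normal.fderiv_right (m := ∞) (by simp)).continuousAt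
    have h2 : ContinuousAt e s := hφ.contDiffAt_normal.continuousAt
    have h3 : ContinuousAt (fun y => (innerSL ℝ (e y)).smulRight (e y)) s := by
      have : Continuous fun w : E3 => (innerSL ℝ w).smulRight w := by
        have := (ContinuousLinearMap.smulRightL ℝ E3 E3).continuous₂
        exact this.comp (Continuous.prodMk (innerSL ℝ).continuous continuous_id)
      exact this.continuousAt.comp h2
    exact h1.clm_comp (continuousAt_const.sub h3)
  refine hc.continuousWithinAt.congr_of_eventuallyEq ?_ (hform s hφ)
  filter_upwards [hφ.eventually_of_mem hΩ] with y hy using hform y hy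

/-- Both sums are the squared Hilbert–Schmidt norm, because the adjoint of `A` takes values in `W`.
The integrand can thus be written in a fixed basis of space while the tangent plane moves. -/
theorem sum_norm_sq_basis_eq {ι : Type*} [Fintype ι] (A : E3 →L[ℝ] E3) (W : Submodule ℝ E3)
    (hA : ∀ v, A (W.starProjection v) = A v) (e : OrthonormalBasis ι ℝ W) :
    ∑ i, ‖A (e i : E3)‖ ^ 2 = ∑ j, ‖A (stdB j)‖ ^ 2 := by
  have h1 : ∀ x : E3, ‖x‖ ^ 2 = ∑ j, ⟪stdB j, x⟫ ^ 2 := fun x => by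
    rw [← stdB.sum_sq_norm_inner_right x]; simp
  have h2 : ∀ x : E3, x ∈ W → ‖x‖ ^ 2 = ∑ i, ⟪(e i : E3), x⟫ ^ 2 := fun x hx => by
    have := e.sum_sq_norm_inner_right ⟨x, hx⟩
    simp only [Submodule.coe_inner, Real.norm_eq_abs, sq_abs, Submodule.coe_norm] at this
    exact this.symm
  have h3 : ∀ x, W.starProjection (ContinuousLinearMap.adjoint A x) =
      ContinuousLinearMap.adjoint A x := fun x => by
    refine ext_inner_right ℝ fun v => ?_
    rw [Submodule.inner_starProjection_left_eq_right, ContinuousLinearMap.adjoint_inner_left,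
      ContinuousLinearMap.adjoint_inner_left, hA]
  have h4 : ∀ x, ContinuousLinearMap.adjoint A x ∈ W := fun x =>
    Submodule.starProjection_eq_self_iff.1 (h3 x)
  have h5 : ∀ x y, ⟪x, A y⟫ = ⟪y, ContinuousLinearMap.adjoint A x⟫ := fun x y => by
    rw [ContinuousLinearMap.adjoint_inner_right, real_inner_comm]
  calc ∑ i, ‖A (e i : E3)‖ ^ 2
      = ∑ i, ∑ j, ⟪(e i : E3), ContinuousLinearMap.adjoint A (stdB j)⟫ ^ 2 := by
        refine Finset.sum_congr rfl fun i _ => ?_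
        rw [h1]; simp_rw [h5]
    _ = ∑ j, ‖ContinuousLinearMap.adjoint A (stdB j)‖ ^ 2 := by
        rw [Finset.sum_comm]
        exact Finset.sum_congr rfl fun j _ => (h2 _ (h4 _)).symm
    _ = ∑ j, ∑ i, ⟪stdB i, ContinuousLinearMap.adjoint A (stdB j)⟫ ^ 2 :=
        Finset.sum_congr rfl fun j _ => h1 _
    _ = _ := by
        rw [Finset.sum_comm]
        refine Finset.sum_congr rfl fun i _ => ?_
        rw [h1 (A _)]; simp_rw [h5]

theorem normalDeriv_starProjection (Ω : Set E3) (s v : E3) :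
    normalDeriv Ω s ((tangentPlane (frontier Ω) s).starProjection v) = normalDeriv Ω s v := by
  rw [normalDeriv, ContinuousLinearMap.comp_apply, ContinuousLinearMap.comp_apply,
    Submodule.starProjection_eq_self_iff.2 (Submodule.starProjection_apply_mem _ v)]

theorem tvIntegrand_eq (Ω : Set E3) (s : E3) :
    tvIntegrand Ω s = Real.sqrt (∑ j, ‖normalDeriv Ω s (stdB j)‖ ^ 2) := by
  rw [tvIntegrand, sum_norm_sq_basis_eq _ _ (normalDeriv_starProjection Ω s)]

theorem tvIntegrand_eq_basis {ι : Type*} [Fintype ι] (Ω : Set E3) (s : E3)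
    (e : OrthonormalBasis ι ℝ (tangentPlane (frontier Ω) s)) :
    tvIntegrand Ω s = Real.sqrt (∑ j, ‖normalDeriv Ω s (e j)‖ ^ 2) := by
  rw [tvIntegrand_eq, sum_norm_sq_basis_eq _ _ (normalDeriv_starProjection Ω s)]

/-! ### Transport of the normal and its derivative by a diffeomorphism. -/

/-- The unit normal of the image of a surface under a map with derivative `F`, if `n` is a normal
of the surface. -/
def pushNormal (z : (E3 →L[ℝ] E3) × E3) : E3 :=
  unitVec (riesz ((innerSL ℝ z.2).comp (Ring.inverse z.1)))

theorem riesz_comp_inverse_ne_zero {F : E3 →L[ℝ] E3} (hF : IsUnit F) {n : E3} (hn : n ≠ 0) :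
    riesz ((innerSL ℝ n).comp (Ring.inverse F)) ≠ 0 := by
  refine riesz_ne_zero fun h0 => hn ?_
  have h1 := congrArg (fun l : E3 →L[ℝ] ℝ => l (F n)) h0
  have h2 : Ring.inverse F (F n) = n := by
    change (Ring.inverse F * F) n = n
    rw [Ring.inverse_mul_cancel F hF]; rfl
  simpa [h2] using h1

theorem norm_pushNormal {F : E3 →L[ℝ] E3} (hF : IsUnit F) {n : E3} (hn : n ≠ 0) :
    ‖pushNormal (F, n)‖ = 1 := norm_unitVec (riesz_comp_inverse_ne_zero hF hn)

theorem inner_pushNormal_eq_zero_iff {F : E3 →L[ℝ] E3} (hF : IsUnit F) {n : E3} (hn : n ≠ 0)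
    (v : E3) : ⟪pushNormal (F, n), v⟫ = 0 ↔ ⟪n, Ring.inverse F v⟫ = 0 := by
  rw [pushNormal, inner_unitVec_eq_zero (riesz_comp_inverse_ne_zero hF hn), inner_riesz]
  simp

theorem contDiffAt_pushNormal {F : E3 →L[ℝ] E3} (hF : IsUnit F) {n : E3} (hn : n ≠ 0) :
    ContDiffAt ℝ ∞ pushNormal (F, n) := by
  obtain ⟨U, rfl⟩ := hF
  have h1 : ContDiffAt ℝ ∞ (fun z : (E3 →L[ℝ] E3) × E3 => Ring.inverse z.1) ((U : E3 →L[ℝ] E3), n) :=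
    ContDiffAt.comp (g := Ring.inverse) _ (contDiffAt_ringInverse ℝ U) contDiffAt_fst
  have h2 : ContDiffAt ℝ ∞ (fun z : (E3 →L[ℝ] E3) × E3 => innerSL ℝ z.2) ((U : E3 →L[ℝ] E3), n) :=
    (innerSL ℝ : E3 →L[ℝ] E3 →L[ℝ] ℝ).contDiff.contDiffAt.comp _ contDiffAt_snd
  exact ContDiffAt.comp (g := unitVec) _
    (contDiffAt_unitVec (riesz_comp_inverse_ne_zero U.isUnit hn))
    (contDiff_riesz.contDiffAt.comp _ (h2.clm_comp h1))

/-- The vector field `D_Γ n` of the image surface, applied to `η`, in terms of the unit normal `n`,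
its derivative `S`, and the first two derivatives `F`, `C` of the map. -/
def pushNormalDeriv (n : E3) (S F : E3 →L[ℝ] E3) (C : E3 →L[ℝ] E3 →L[ℝ] E3) (η : E3) : E3 :=
  fderiv ℝ pushNormal (F, n)
    (C (Ring.inverse F (η - ⟪pushNormal (F, n), η⟫ • pushNormal (F, n))),
     S (Ring.inverse F (η - ⟪pushNormal (F, n), η⟫ • pushNormal (F, n))))

section Diffeo

variable {T : E3 ≃ₜ E3} (hT : ContDiff ℝ ∞ T) (hT' : ContDiff ℝ ∞ T.symm)
include hT hT'

theorem fderiv_mul_fderiv_symm (s : E3) :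
    fderiv ℝ T s * fderiv ℝ T.symm (T s) = 1 ∧ fderiv ℝ T.symm (T s) * fderiv ℝ T s = 1 := by
  have h1 := (hT.differentiable (by simp) s).hasFDerivAt
  have h2 := (hT'.differentiable (by simp) (T s)).hasFDerivAt
  have h3 : HasFDerivAt (T.symm ∘ T) (fderiv ℝ T.symm (T s) * fderiv ℝ T s) s := h2.comp s h1
  have h4 : HasFDerivAt (T ∘ T.symm) (fderiv ℝ T s * fderiv ℝ T.symm (T s)) (T s) := by
    refine HasFDerivAt.comp (T s) ?_ h2
    simpa using h1
  constructor
  · refine h4.unique ?_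
    have : T ∘ T.symm = id := by ext1 x; simp
    rw [this]; exact hasFDerivAt_id _
  · refine h3.unique ?_
    have : T.symm ∘ T = id := by ext1 x; simp
    rw [this]; exact hasFDerivAt_id _

theorem isUnit_fderiv (s : E3) : IsUnit (fderiv ℝ T s) :=
  have h := fderiv_mul_fderiv_symm hT hT' s
  ⟨⟨_, _, h.1, h.2⟩, rfl⟩

theorem inverse_fderiv (s : E3) : Ring.inverse (fderiv ℝ T s) = fderiv ℝ T.symm (T s) :=
  have h := fderiv_mul_fderiv_symm hT hT' s
  Ring.inverse_unit ⟨_, _, h.1, h.2⟩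

variable {Ω : Set E3} {s : E3}

theorem IsLocalDefiningFunction.image {φ : E3 → ℝ} (h : IsLocalDefiningFunction Ω s φ) :
    IsLocalDefiningFunction (T '' Ω) (T s) (φ ∘ T.symm) ∧
    fderiv ℝ (φ ∘ T.symm) (T s) = (fderiv ℝ φ s).comp (Ring.inverse (fderiv ℝ T s)) := by
  have h1 : fderiv ℝ (φ ∘ T.symm) (T s) =
      (fderiv ℝ φ s).comp (Ring.inverse (fderiv ℝ T s)) := by
    rw [inverse_fderiv hT hT', fderiv_comp _ (h.contDiff.differentiable (by simp) _)
      (hT'.differentiable (by simp) _), T.symm_apply_apply]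
  refine ⟨⟨h.contDiff.comp hT', by simp [h.eq_zero], fun h0 => h.fderiv_ne ?_, ?_⟩, h1⟩
  · rw [h1, inverse_fderiv hT hT'] at h0
    calc fderiv ℝ φ s = ((fderiv ℝ φ s).comp (fderiv ℝ T.symm (T s))).comp (fderiv ℝ T s) := by
          rw [ContinuousLinearMap.comp_assoc]
          have := (fderiv_mul_fderiv_symm hT hT' s).2
          rw [ContinuousLinearMap.mul_def] at this
          rw [this]; rfl
      _ = 0 := by rw [h0]; rfl
  · have : Tendsto T.symm (𝓝 (T s)) (𝓝 s) := by
      simpa using T.symm.continuous.tendsto (T s)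
    filter_upwards [this.eventually h.mem_iff] with y hy
    rw [Function.comp_apply, ← hy, T.image_eq_preimage_symm]; rfl

variable (hΩ : IsOpen Ω) (hs : HasSmoothBoundary Ω)
include hs

theorem HasSmoothBoundary.image : HasSmoothBoundary (T '' Ω) := by
  intro y hy
  rw [← T.image_frontier] at hy
  obtain ⟨s, hs', rfl⟩ := hy
  obtain ⟨φ, hφ⟩ := hs.exists_localDefiningFunction hs'
  obtain ⟨h, -⟩ := hφ.image hT hT'
  exact ⟨_, h.contDiff, h.eq_zero, h.fderiv_ne, h.mem_iff⟩

variable (h : s ∈ frontier Ω)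
include hΩ h

/-- The image has defining function `φ ∘ T⁻¹`, with gradient covector `dφ ∘ DT⁻¹`. Normalization
ignores positive factors, so `dφ` may be replaced by the unit normal. -/
theorem outerNormal_image : outerNormal (T '' Ω) (T s) =
    pushNormal (fderiv ℝ T s, outerNormal Ω s) := by
  obtain ⟨φ, hφ⟩ := hs.exists_localDefiningFunction h
  obtain ⟨h1, h2⟩ := hφ.image hT hT'
  rw [h1.outerNormal_eq (T.isOpenMap _ hΩ), hφ.outerNormal_eq hΩ, h2, pushNormal]
  have hg : 0 < ‖riesz (fderiv ℝ φ s)‖⁻¹ := by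
    have := norm_pos_iff.2 (riesz_ne_zero hφ.fderiv_ne)
    positivity
  rw [← unitVec_smul hg]
  congr 1
  refine ext_inner_right ℝ fun v => ?_
  rw [inner_riesz, inner_smul_left, inner_riesz]
  simp [unitVec, inner_riesz]

/-- The chain rule for the identity of `outerNormal_image` along `Γ`, composed with `T⁻¹`: the
tangential part of `η` is pulled back by `DT⁻¹` and then moves both `DT` and the normal. -/
theorem normalDeriv_image (η : E3) : normalDeriv (T '' Ω) (T s) η =
    pushNormalDeriv (outerNormal Ω s) (normalDeriv Ω s) (fderiv ℝ T s)
      (fderiv ℝ (fderiv ℝ T) s) η := by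
  have hn0 : outerNormal Ω s ≠ 0 := fun h0 => by
    have := norm_outerNormal hΩ hs h
    rw [h0, norm_zero] at this; norm_num at this
  have hfr : frontier (T '' Ω) = T '' frontier Ω := (T.image_frontier Ω).symm
  have hF := isUnit_fderiv hT hT' s
  have hL := (differentiableWithinAt_outerNormal hΩ hs h).hasFDerivWithinAt
  set L := fderivWithin ℝ (outerNormal Ω) (frontier Ω) s
  have hT2 : HasFDerivAt (fderiv ℝ T) (fderiv ℝ (fderiv ℝ T) s) s :=
    ((hT.fderiv_right (m := ∞) (by simp)).differentiable (by simp) s).hasFDerivAt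
  have hN : HasFDerivAt pushNormal _ (fderiv ℝ T s, outerNormal Ω s) :=
    ((contDiffAt_pushNormal hF hn0).differentiableAt (by simp)).hasFDerivAt
  have hm : HasFDerivWithinAt (fun x => pushNormal (fderiv ℝ T x, outerNormal Ω x)) _
      (frontier Ω) s :=
    HasFDerivAt.comp_hasFDerivWithinAt (g := pushNormal)
      (f := fun x => (fderiv ℝ T x, outerNormal Ω x)) s hN (hT2.hasFDerivWithinAt.prodMk hL)
  have hS : HasFDerivWithinAt T.symm (fderiv ℝ T.symm (T s)) (T '' frontier Ω) (T s) :=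
    (hT'.differentiable (by simp) (T s)).hasFDerivAt.hasFDerivWithinAt
  have hcomp : HasFDerivWithinAt (outerNormal (T '' Ω))
      (((fderiv ℝ pushNormal (fderiv ℝ T s, outerNormal Ω s)).comp
        ((fderiv ℝ (fderiv ℝ T) s).prod L)).comp (fderiv ℝ T.symm (T s)))
      (frontier (T '' Ω)) (T s) := by
    rw [hfr]
    rw [← T.symm_apply_apply s] at hm
    have hmaps : Set.MapsTo T.symm (T '' frontier Ω) (frontier Ω) := by
      rintro _ ⟨x, hx, rfl⟩; simpa using hx
    have := HasFDerivWithinAt.comp (T s) hm hS hmaps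
    simp only [T.symm_apply_apply] at this
    refine this.congr ?_ ?_
    · rintro _ ⟨x, hx, rfl⟩
      simp [outerNormal_image hT hT' hΩ hs hx]
    · simp [outerNormal_image hT hT' hΩ hs h]
  have hmem : T s ∈ frontier (T '' Ω) := by rw [hfr]; exact ⟨s, h, rfl⟩
  rw [normalDeriv_apply (T.isOpenMap _ hΩ) (hs.image hT hT') hmem hcomp, pushNormalDeriv,
    outerNormal_image hT hT' hΩ hs h, inverse_fderiv hT hT']
  set m := pushNormal (fderiv ℝ T s, outerNormal Ω s)
  set ζ := fderiv ℝ T.symm (T s) (η - ⟪m, η⟫ • m) with hζ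
  -- The pulled back vector is tangent to `Γ`, so the derivative of the normal within `Γ` may be
  -- replaced by `normalDeriv`, independently of how the former acts on normal vectors.
  have hζt : ⟪outerNormal Ω s, ζ⟫ = 0 := by
    rw [hζ, ← inverse_fderiv hT hT', ← inner_pushNormal_eq_zero_iff hF hn0]
    simp [m, inner_sub_right, inner_smul_right, norm_pushNormal hF hn0]
  have : normalDeriv Ω s ζ = L ζ := by
    rw [normalDeriv_apply hΩ hs h hL, hζt, zero_smul, sub_zero]
  rw [this]
  rfl

end Diffeo

/-! ### Perturbations of the identity. -/

section Perturb

variable {V : E3 → E3}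

theorem hasFDerivAt_perturb (hV : ContDiff ℝ ∞ V) (ε : ℝ) (s : E3) :
    HasFDerivAt (perturb V ε) (1 + ε • fderiv ℝ V s) s :=
  (hasFDerivAt_id s).add ((hV.differentiable (by simp) s).hasFDerivAt.const_smul ε)

theorem fderiv_perturb (hV : ContDiff ℝ ∞ V) (ε : ℝ) :
    fderiv ℝ (perturb V ε) = fun s => 1 + ε • fderiv ℝ V s :=
  funext fun s => (hasFDerivAt_perturb hV ε s).fderiv

theorem fderiv_fderiv_perturb (hV : ContDiff ℝ ∞ V) (ε : ℝ) (s : E3) :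
    fderiv ℝ (fderiv ℝ (perturb V ε)) s = ε • fderiv ℝ (fderiv ℝ V) s := by
  rw [fderiv_perturb hV]
  have h : HasFDerivAt (fderiv ℝ V) (fderiv ℝ (fderiv ℝ V) s) s :=
    ((hV.fderiv_right (m := ∞) (by simp)).differentiable (by simp) s).hasFDerivAt
  exact ((h.const_smul ε).const_add _).fderiv

theorem contDiff_perturb (hV : ContDiff ℝ ∞ V) (ε : ℝ) : ContDiff ℝ ∞ (perturb V ε) := by
  unfold perturb; fun_prop

/-- For small `ε` the perturbation of identity is a diffeomorphism. -/
theorem eventually_exists_homeomorph_perturb (hV : ContDiff ℝ ∞ V) (hVc : HasCompactSupport V) :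
    ∀ᶠ ε in 𝓝 (0 : ℝ), ∃ T : E3 ≃ₜ E3, ⇑T = perturb V ε ∧ ContDiff ℝ ∞ T ∧ ContDiff ℝ ∞ T.symm ∧
      LipschitzWith 2 T := by
  obtain ⟨C, hC⟩ := (hV.continuous_fderiv (by simp)).bounded_above_of_compact_support
    (hVc.fderiv ℝ)
  have hC0 : 0 ≤ C := (norm_nonneg _).trans (hC 0)
  -- Then `ε V` is a contraction, which yields a homeomorphism with Lipschitz constant below `2`,
  -- and a Neumann series inverts the derivative.
  have hev : ∀ᶠ ε in 𝓝 (0 : ℝ), |ε| * C < 1 / 2 := by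
    have : Continuous fun ε : ℝ => |ε| * C := by fun_prop
    have h := this.tendsto 0
    simp only [abs_zero, zero_mul] at h
    exact h.eventually_lt_const (by norm_num)
  filter_upwards [hev] with ε hε
  have hlip : ∀ x y, ‖V x - V y‖ ≤ C * ‖x - y‖ := fun x y =>
    Convex.norm_image_sub_le_of_norm_fderiv_le (fun z _ => hV.differentiable (by simp) z)
      (fun z _ => hC z) convex_univ (Set.mem_univ _) (Set.mem_univ _)
  obtain ⟨c, hc⟩ : ∃ c : NNReal, (c : ℝ) = |ε| * C := ⟨⟨|ε| * C, by positivity⟩, rfl⟩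
  have hpert : ∀ x y, ‖perturb V ε x - perturb V ε y - (x - y)‖ ≤ c * ‖x - y‖ := by
    intro x y
    have : perturb V ε x - perturb V ε y - (x - y) = ε • (V x - V y) := by
      simp only [perturb, smul_sub]; abel
    rw [this, norm_smul, Real.norm_eq_abs]
    calc |ε| * ‖V x - V y‖ ≤ |ε| * (C * ‖x - y‖) := by gcongr; exact hlip x y
      _ = _ := by rw [hc]; ring
  have happ : ApproximatesLinearOn (perturb V ε)
      ((ContinuousLinearEquiv.refl ℝ E3 : E3 ≃L[ℝ] E3) : E3 →L[ℝ] E3) Set.univ c :=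
    fun x _ y _ => hpert x y
  have hc1 : c < 1 / 2 := by
    rw [← NNReal.coe_lt_coe, hc]; simpa using hε
  have hnorm : ‖(((ContinuousLinearEquiv.refl ℝ E3).symm : E3 ≃L[ℝ] E3) : E3 →L[ℝ] E3)‖₊ = 1 := by
    have : (((ContinuousLinearEquiv.refl ℝ E3).symm : E3 ≃L[ℝ] E3) : E3 →L[ℝ] E3) = 1 := rfl
    rw [this, nnnorm_one]
  let T : E3 ≃ₜ E3 := happ.toHomeomorph (perturb V ε) (Or.inr (by
    rw [hnorm, inv_one]; exact hc1.trans (by norm_num)))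
  have hTe : ⇑T = perturb V ε := rfl
  have hTc : ContDiff ℝ ∞ T := hTe ▸ contDiff_perturb hV ε
  have hunit : ∀ x, IsUnit (1 + ε • fderiv ℝ V x) := by
    intro x
    have h1 : ‖-(ε • fderiv ℝ V x)‖ < 1 := by
      rw [norm_neg, norm_smul, Real.norm_eq_abs]
      calc |ε| * ‖fderiv ℝ V x‖ ≤ |ε| * C := by gcongr; exact hC x
        _ < 1 := hε.trans (by norm_num)
    simpa using (Units.oneSub _ h1).isUnit
  refine ⟨T, hTe, hTc, ?_, ?_⟩
  · refine T.contDiff_symm (f₀' := fun x => ContinuousLinearEquiv.ofUnit (hunit x).unit) ?_ hTc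
    intro x
    exact hasFDerivAt_perturb hV ε x
  · refine LipschitzWith.of_dist_le_mul fun x y => ?_
    rw [dist_eq_norm, dist_eq_norm, hTe]
    have h1 := hpert x y
    have h2 : ‖perturb V ε x - perturb V ε y‖ ≤
      ‖perturb V ε x - perturb V ε y - (x - y)‖ + ‖x - y‖ := norm_le_norm_sub_add _ _
    have h3 : (c : ℝ) < 1 / 2 := by exact_mod_cast hc1
    have h4 := norm_nonneg (x - y)
    push_cast
    nlinarith

end Perturb

/-! ### Uniform Lipschitz bounds and differentiation under the integral. -/

theorem contDiffAt_pushNormalDeriv {X : Type*} [NormedAddCommGroup X] [NormedSpace ℝ X] {x : X}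
    {n η : X → E3} {S F : X → E3 →L[ℝ] E3} {C : X → E3 →L[ℝ] E3 →L[ℝ] E3}
    (hn : ContDiffAt ℝ ∞ n x) (hη : ContDiffAt ℝ ∞ η x) (hS : ContDiffAt ℝ ∞ S x)
    (hF : ContDiffAt ℝ ∞ F x) (hC : ContDiffAt ℝ ∞ C x) (hFu : IsUnit (F x)) (hn0 : n x ≠ 0) :
    ContDiffAt ℝ ∞ (fun y => pushNormalDeriv (n y) (S y) (F y) (C y) (η y)) x := by
  have hp := contDiffAt_pushNormal hFu hn0
  have h1 : ContDiffAt ℝ ∞ (fun y => pushNormal (F y, n y)) x :=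
    ContDiffAt.comp (g := pushNormal) x hp (hF.prodMk hn)
  have h2 : ContDiffAt ℝ ∞ (fun y => fderiv ℝ pushNormal (F y, n y)) x :=
    ContDiffAt.comp (g := fderiv ℝ pushNormal) x (hp.fderiv_right (m := ∞) (by simp))
      (hF.prodMk hn)
  have h3 : ContDiffAt ℝ ∞ (fun y => Ring.inverse (F y)) x := by
    obtain ⟨U, hU⟩ := hFu
    exact ContDiffAt.comp (g := Ring.inverse) x (hU ▸ contDiffAt_ringInverse ℝ U) hF
  have h4 : ContDiffAt ℝ ∞ (fun y => Ring.inverse (F y)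
      (η y - ⟪pushNormal (F y, n y), η y⟫ • pushNormal (F y, n y))) x :=
    h3.clm_apply (hη.sub ((h1.inner ℝ hη).smul h1))
  exact h2.clm_apply ((hC.clm_apply h4).prodMk (hS.clm_apply h4))

/-- A function that is continuously differentiable at the points of `K × {0}`, `K` compact, is
Lipschitz in the second variable at `0`, uniformly on `K`. -/
theorem exists_uniform_lipschitz {P J Y : Type*} [NormedAddCommGroup P] [NormedSpace ℝ P]
    [NormedAddCommGroup J] [NormedSpace ℝ J] [NormedAddCommGroup Y] [NormedSpace ℝ Y]
    {K : Set P} (hK : IsCompact K) {f : P → J → Y}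
    (hf : ∀ p ∈ K, ContDiffAt ℝ 1 (Function.uncurry f) (p, 0)) :
    ∃ C : ℝ, 0 ≤ C ∧ ∃ r > 0, ∀ p ∈ K, ∀ j, ‖j‖ < r → ‖f p j - f p 0‖ ≤ C * ‖j‖ := by
  refine hK.induction_on (p := fun S => ∃ C : ℝ, 0 ≤ C ∧ ∃ r > 0, ∀ p ∈ S, ∀ j, ‖j‖ < r →
    ‖f p j - f p 0‖ ≤ C * ‖j‖) ⟨0, le_rfl, 1, one_pos, by simp⟩ ?_ ?_ ?_
  · rintro s t hst ⟨C, hC, r, hr, h⟩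
    exact ⟨C, hC, r, hr, fun p hp => h p (hst hp)⟩
  · rintro s t ⟨C, hC, r, hr, h⟩ ⟨C', hC', r', hr', h'⟩
    refine ⟨max C C', hC.trans (le_max_left _ _), min r r', lt_min hr hr', ?_⟩
    rintro p (hp | hp) j hj
    · exact (h p hp j (hj.trans_le (min_le_left _ _))).trans (by gcongr; exact le_max_left _ _)
    · exact (h' p hp j (hj.trans_le (min_le_right _ _))).trans (by gcongr; exact le_max_right _ _)
  · intro p hp
    obtain ⟨C, t, ht, hC⟩ := (hf p hp).exists_lipschitzOnWith
    rw [nhds_prod_eq] at ht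
    obtain ⟨U, hU, W, hW, hUW⟩ := Filter.mem_prod_iff.1 ht
    obtain ⟨r, hr, hrW⟩ := Metric.mem_nhds_iff.1 hW
    refine ⟨U, mem_nhdsWithin_of_mem_nhds hU, C, C.2, r, hr, fun q hq j hj => ?_⟩
    have h1 : (q, j) ∈ t := hUW ⟨hq, hrW (by simpa using hj)⟩
    have h2 : (q, (0 : J)) ∈ t := hUW ⟨hq, mem_of_mem_nhds hW⟩
    simpa using hC.norm_sub_le h1 h2

/-- Differentiation under the integral sign, with a bounded Lipschitz constant at the base point. -/
theorem integrable_and_tendsto_of_lipschitz {X : Type*} [MeasurableSpace X] {μ : Measure X}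
    [IsFiniteMeasure μ] {f : ℝ → X → ℝ} {f' : X → ℝ} {C : ℝ}
    (hmeas : ∀ᶠ ε in 𝓝 (0 : ℝ), AEStronglyMeasurable (f ε) μ) (hint : Integrable (f 0) μ)
    (hlip : ∀ᶠ ε in 𝓝 (0 : ℝ), ∀ᵐ x ∂μ, |f ε x - f 0 x| ≤ C * |ε|)
    (hderiv : ∀ᵐ x ∂μ, HasDerivAt (fun ε => f ε x) (f' x) 0) :
    Integrable f' μ ∧
      Tendsto (fun ε => ((∫ x, f ε x ∂μ) - ∫ x, f 0 x ∂μ) / ε) (𝓝[>] 0) (𝓝 (∫ x, f' x ∂μ)) := by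
  have hle : 𝓝[>] (0 : ℝ) ≤ 𝓝 0 := nhdsWithin_le_nhds
  have hint' : ∀ᶠ ε in 𝓝 (0 : ℝ), Integrable (f ε) μ := by
    filter_upwards [hmeas, hlip] with ε h1 h2
    have : Integrable (fun x => f ε x - f 0 x) μ :=
      Integrable.of_bound (h1.sub hint.1) (C * |ε|) (h2.mono fun x hx => hx)
    exact (this.add hint).congr (Eventually.of_forall fun x => by simp)
  have hlim : ∀ᵐ x ∂μ, Tendsto (fun ε => (f ε x - f 0 x) / ε) (𝓝[>] 0) (𝓝 (f' x)) := by
    filter_upwards [hderiv] with x hx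
    refine ((hasDerivAt_iff_tendsto_slope.1 hx).mono_left
      (nhdsWithin_mono (0 : ℝ) (fun x (hx : 0 < x) => hx.ne'))).congr fun ε => ?_
    simp [slope, div_eq_inv_mul]
  have hqm : ∀ᶠ ε in 𝓝[>] (0 : ℝ), AEStronglyMeasurable (fun x => (f ε x - f 0 x) / ε) μ := by
    filter_upwards [hle hmeas] with ε h1
    simp only [div_eq_mul_inv]
    exact (h1.sub hint.1).mul_const _
  have hqb : ∀ᶠ ε in 𝓝[>] (0 : ℝ), ∀ᵐ x ∂μ, ‖(f ε x - f 0 x) / ε‖ ≤ C := by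
    filter_upwards [hle hlip, self_mem_nhdsWithin] with ε h1 (h2 : 0 < ε)
    filter_upwards [h1] with x hx
    rw [norm_div, Real.norm_eq_abs, Real.norm_eq_abs, div_le_iff₀ (abs_pos.2 h2.ne')]
    exact hx
  -- Measurability of `f'` comes from a sequence of difference quotients, chosen among those `ε` for
  -- which measurability and the bound are available.
  obtain ⟨u, hu, hu'⟩ : ∃ u : ℕ → ℝ, Tendsto u atTop (𝓝[>] 0) ∧ ∀ n,
      AEStronglyMeasurable (fun x => (f (u n) x - f 0 x) / u n) μ ∧
      ∀ᵐ x ∂μ, ‖(f (u n) x - f 0 x) / u n‖ ≤ C :=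
    Filter.exists_seq_forall_of_frequently (l := 𝓝[>] (0 : ℝ)) (hqm.and hqb).frequently
  have hf'm : AEStronglyMeasurable f' μ :=
    aestronglyMeasurable_of_tendsto_ae atTop (fun n => (hu' n).1)
      (hlim.mono fun x hx => hx.comp hu)
  have hf'b : ∀ᵐ x ∂μ, ‖f' x‖ ≤ C := by
    filter_upwards [hlim, ae_all_iff.2 fun n => (hu' n).2] with x hx hb
    exact le_of_tendsto (hx.comp hu).norm (Eventually.of_forall hb)
  refine ⟨Integrable.of_bound hf'm C hf'b, ?_⟩
  refine (tendsto_integral_filter_of_dominated_convergence (fun _ => C) hqm hqb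
    (integrable_const C) hlim).congr' ?_
  filter_upwards [hle hint'] with ε hε
  rw [integral_div, integral_sub hε hint]

theorem contDiff_smul_vector {G : Type*} [NormedAddCommGroup G] [NormedSpace ℝ G] (a : G) :
    ContDiff ℝ ∞ fun ε : ℝ => ε • a :=
  contDiff_id.smul contDiff_const

theorem zero_smul_vector {G : Type*} [NormedAddCommGroup G] [NormedSpace ℝ G] (a : G) :
    (0 : ℝ) • a = 0 :=
  zero_smul ℝ a

/-! ### The pulled back integrand as a function of surface data and jets. -/

/-- Values of the first two derivatives of a vector field. -/
abbrev Jet : Type := (E3 →L[ℝ] E3) × (E3 →L[ℝ] E3 →L[ℝ] E3)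

instance : NormedAddCommGroup Jet := Prod.normedAddCommGroup

instance : NormedSpace ℝ Jet := Prod.normedSpace

instance : Module ℝ Jet := NormedSpace.toModule

/-- The first two derivatives of the vector field `V`. -/
def jet (V : E3 → E3) (x : E3) : Jet := (fderiv ℝ V x, fderiv ℝ (fderiv ℝ V) x)

/-- Pointwise data of a surface: normal, derivative of the normal, and a tangent frame. -/
abbrev SurfaceData : Type := E3 × (E3 →L[ℝ] E3) × E3 × E3

/-- The derivative of the normal of the surface perturbed by a vector field with jet `j`,
as the vector of its columns. -/
def pushCurvature (p : SurfaceData) (j : Jet) : PiLp 2 (fun _ : Fin 3 => E3) :=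
  WithLp.toLp 2 fun i => pushNormalDeriv p.1 p.2.1 (1 + j.1) j.2 (stdB i)

/-- The tangential Jacobian of the perturbation by a vector field with jet `j`. -/
def pushArea (p : SurfaceData) (j : Jet) : ℝ :=
  gramArea ((1 + j.1) p.2.2.1) ((1 + j.1) p.2.2.2)

theorem pushArea_nonneg (p : SurfaceData) (j : Jet) : 0 ≤ pushArea p j := Real.sqrt_nonneg _

/-- Data with unit normals, curvature bounded by `M` and orthonormal frames. -/
def dataSet (M : ℝ) : Set SurfaceData :=
  {p | ‖p.1‖ = 1 ∧ ‖p.2.1‖ ≤ M ∧ ‖p.2.2.1‖ = 1 ∧ ‖p.2.2.2‖ = 1 ∧ ⟪p.2.2.1, p.2.2.2⟫ = 0}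

/-- Frames will be chosen pointwise without continuity, so uniform constants are drawn from the
compact set of all admissible data instead of from `Γ`. -/
theorem isCompact_dataSet (M : ℝ) : IsCompact (dataSet M) := by
  have hsub : dataSet M ⊆ Metric.closedBall (0 : E3) 1 ×ˢ
      Metric.closedBall (0 : E3 →L[ℝ] E3) M ×ˢ Metric.closedBall (0 : E3) 1 ×ˢ
        Metric.closedBall (0 : E3) 1 := by
    rintro p ⟨h1, h2, h3, h4, -⟩
    simp [Set.mem_prod, h1, h2, h3, h4]
  have : ProperSpace (E3 →L[ℝ] E3) := FiniteDimensional.proper_real _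
  refine IsCompact.of_isClosed_subset ((isCompact_closedBall _ _).prod
    ((isCompact_closedBall _ _).prod ((isCompact_closedBall _ _).prod
      (isCompact_closedBall _ _)))) ?_ hsub
  have c1 : IsClosed {p : SurfaceData | ‖p.1‖ = 1} := isClosed_eq (by fun_prop) continuous_const
  have c2 : IsClosed {p : SurfaceData | ‖p.2.1‖ ≤ M} := isClosed_le (by fun_prop) continuous_const
  have c3 : IsClosed {p : SurfaceData | ‖p.2.2.1‖ = 1} := isClosed_eq (by fun_prop) continuous_const
  have c4 : IsClosed {p : SurfaceData | ‖p.2.2.2‖ = 1} := isClosed_eq (by fun_prop) continuous_const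
  have c5 : IsClosed {p : SurfaceData | ⟪p.2.2.1, p.2.2.2⟫ = 0} :=
    isClosed_eq (by fun_prop) continuous_const
  exact c1.inter (c2.inter (c3.inter (c4.inter c5)))

theorem contDiffAt_pushCurvature {p : SurfaceData} (hp : p.1 ≠ 0) :
    ContDiffAt ℝ ∞ (Function.uncurry pushCurvature) (p, 0) := by
  have h : ContDiffAt ℝ ∞ (fun z : SurfaceData × Jet => fun i : Fin 3 =>
      pushNormalDeriv z.1.1 z.1.2.1 (1 + z.2.1) z.2.2 (stdB i)) (p, 0) := by
    refine contDiffAt_pi.2 fun i => ?_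
    exact contDiffAt_pushNormalDeriv (n := fun z : SurfaceData × Jet => z.1.1)
      (S := fun z => z.1.2.1) (F := fun z => 1 + z.2.1) (C := fun z => z.2.2)
      (η := fun _ => stdB i) (by fun_prop) (by fun_prop) (by fun_prop) (by fun_prop) (by fun_prop)
      (by simp) hp
  exact (PiLp.contDiff_toLp (𝕜 := ℝ) (p := 2)).contDiffAt.comp _ h

theorem contDiffAt_pushArea {p : SurfaceData} (h1 : ‖p.2.2.1‖ = 1) (h2 : ‖p.2.2.2‖ = 1)
    (h3 : ⟪p.2.2.1, p.2.2.2⟫ = 0) :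
    ContDiffAt ℝ ∞ (Function.uncurry pushArea) (p, 0) := by
  have ha : ContDiffAt ℝ ∞ (fun z : SurfaceData × Jet => (1 + z.2.1) z.1.2.2.1) (p, 0) :=
    ContDiffAt.clm_apply (by fun_prop) (by fun_prop)
  have hb : ContDiffAt ℝ ∞ (fun z : SurfaceData × Jet => (1 + z.2.1) z.1.2.2.2) (p, 0) :=
    ContDiffAt.clm_apply (by fun_prop) (by fun_prop)
  exact ContDiffAt.sqrt (((ha.norm_sq ℝ).mul (hb.norm_sq ℝ)).sub ((ha.inner ℝ hb).pow 2))
    (by simp [h1, h2, h3])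

/-- For an orthonormal frame the Gram determinant is `1` at `ε = 0`, so the square root is smooth
there and halves its derivative. The result is the tangential divergence. -/
theorem hasDerivAt_pushArea {p : SurfaceData} (h1 : ‖p.2.2.1‖ = 1) (h2 : ‖p.2.2.2‖ = 1)
    (h3 : ⟪p.2.2.1, p.2.2.2⟫ = 0) (j : Jet) :
    HasDerivAt (fun ε : ℝ => pushArea p (ε • j))
      (⟪p.2.2.1, j.1 p.2.2.1⟫ + ⟪p.2.2.2, j.1 p.2.2.2⟫) 0 := by
  have ha : ∀ w z : E3, HasDerivAt (fun ε : ℝ => w + ε • z) z 0 := by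
    intro w z
    simpa using ((hasDerivAt_id (0 : ℝ)).smul_const z).const_add w
  have ha1 := ha p.2.2.1 (j.1 p.2.2.1)
  have ha2 := ha p.2.2.2 (j.1 p.2.2.2)
  have h := ((ha1.norm_sq.fun_mul ha2.norm_sq).fun_sub ((ha1.inner ℝ ha2).fun_pow 2)).sqrt
    (by simp [h1, h2, h3])
  refine HasDerivAt.congr_deriv (f := fun ε : ℝ => pushArea p (ε • j)) h ?_
  simp [h1, h2, h3]
  ring

theorem pushArea_zero {p : SurfaceData} (h1 : ‖p.2.2.1‖ = 1) (h2 : ‖p.2.2.2‖ = 1)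
    (h3 : ⟪p.2.2.1, p.2.2.2⟫ = 0) : pushArea p 0 = 1 := by
  simp [pushArea, gramArea, h1, h2, h3]

/-- The orthonormal basis of a plane given by two orthonormal vectors. -/
theorem exists_orthonormalBasis_of_orthonormal {W : Submodule ℝ E3} (hW : Module.finrank ℝ W = 2)
    {u v : E3} (hu : ‖u‖ = 1) (hv : ‖v‖ = 1) (huv : ⟪u, v⟫ = 0) (huW : u ∈ W) (hvW : v ∈ W) :
    ∃ e : OrthonormalBasis (Fin 2) ℝ W, (e 0 : E3) = u ∧ (e 1 : E3) = v := by
  have hon : Orthonormal ℝ ![(⟨u, huW⟩ : W), ⟨v, hvW⟩] := by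
    rw [orthonormal_iff_ite]
    have h1 := real_inner_self_eq_norm_sq u
    have h2 := real_inner_self_eq_norm_sq v
    have h4 := real_inner_comm u v
    rw [hu] at h1; rw [hv] at h2
    intro i j
    fin_cases i <;> fin_cases j <;> simp_all
  have hspan : ⊤ ≤ Submodule.span ℝ (Set.range ![(⟨u, huW⟩ : W), ⟨v, hvW⟩]) := by
    rw [hon.linearIndependent.span_eq_top_of_card_eq_finrank' (by simp [hW])]
  exact ⟨OrthonormalBasis.mk hon hspan, by simp [OrthonormalBasis.coe_mk],
    by simp [OrthonormalBasis.coe_mk]⟩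

/-! ### Tangent frames on the boundary and material derivatives. -/

section Boundary

variable {Ω : Set E3} (hΩ : IsOpen Ω) (hs : HasSmoothBoundary Ω)
include hΩ hs

theorem exists_frame : ∃ u v : E3 → E3, ∀ x ∈ frontier Ω, ‖u x‖ = 1 ∧ ‖v x‖ = 1 ∧ ⟪u x, v x⟫ = 0 ∧
    ⟪outerNormal Ω x, u x⟫ = 0 ∧ ⟪outerNormal Ω x, v x⟫ = 0 ∧
    ∀ V : E3 → E3, tangentialDiv (frontier Ω) V x =
      ⟪u x, fderiv ℝ V x (u x)⟫ + ⟪v x, fderiv ℝ V x (v x)⟫ := by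
  have h : ∀ x, ∃ u v : E3, x ∈ frontier Ω → ‖u‖ = 1 ∧ ‖v‖ = 1 ∧ ⟪u, v⟫ = 0 ∧
      ⟪outerNormal Ω x, u⟫ = 0 ∧ ⟪outerNormal Ω x, v⟫ = 0 ∧
      ∀ V : E3 → E3, tangentialDiv (frontier Ω) V x =
        ⟪u, fderiv ℝ V x u⟫ + ⟪v, fderiv ℝ V x v⟫ := by
    intro x
    by_cases hx : x ∈ frontier Ω
    · have hfin := finrank_tangentPlane hΩ hs hx
      let e := (stdOrthonormalBasis ℝ (tangentPlane (frontier Ω) x)).reindex (finCongr hfin)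
      refine ⟨e 0, e 1, fun _ => ⟨?_, ?_, ?_, ?_, ?_, fun V => ?_⟩⟩
      · rw [← Submodule.coe_norm]; exact e.norm_eq_one 0
      · rw [← Submodule.coe_norm]; exact e.norm_eq_one 1
      · rw [← Submodule.coe_inner]; exact e.inner_eq_zero (by decide)
      · exact (mem_tangentPlane_iff hΩ hs hx _).1 (e 0).2
      · exact (mem_tangentPlane_iff hΩ hs hx _).1 (e 1).2
      · rw [tangentialDiv, ← Fin.sum_univ_two (fun i => ⟪(e i : E3), fderiv ℝ V x (e i : E3)⟫)]
        rw [← Equiv.sum_comp (finCongr hfin)]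
        simp [e]
    · exact ⟨0, 0, fun h => absurd h hx⟩
  choose u v huv using h
  exact ⟨u, v, huv⟩

variable {V : E3 → E3} (hV : ContDiff ℝ ∞ V)
include hV

theorem normalDeriv_perturb {ε : ℝ} {T : E3 ≃ₜ E3} (hT : ⇑T = perturb V ε)
    (hT' : ContDiff ℝ ∞ T.symm) {x : E3} (hx : x ∈ frontier Ω) (η : E3) :
    normalDeriv (perturbedDomain V Ω ε) (perturb V ε x) η =
      pushNormalDeriv (outerNormal Ω x) (normalDeriv Ω x) (1 + (ε • jet V x).1) (ε • jet V x).2 η := by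
  have := normalDeriv_image (T := T) (hT ▸ contDiff_perturb hV ε) hT' hΩ hs hx η
  rw [hT, fderiv_fderiv_perturb hV, fderiv_perturb hV] at this
  exact this

/-- The key reduction: at a fixed `x` the perturbation enters only through the vector `ε • jet V x`.
The frame `u, v` is arbitrary, since `pushCurvature` does not use it. -/
theorem tvIntegrand_perturb {ε : ℝ} {T : E3 ≃ₜ E3} (hT : ⇑T = perturb V ε)
    (hT' : ContDiff ℝ ∞ T.symm) {x : E3} (hx : x ∈ frontier Ω) (u v : E3) :
    tvIntegrand (perturbedDomain V Ω ε) (perturb V ε x) =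
      ‖pushCurvature (outerNormal Ω x, normalDeriv Ω x, u, v) (ε • jet V x)‖ := by
  rw [tvIntegrand_eq, PiLp.norm_eq_of_L2]
  simp only [normalDeriv_perturb hΩ hs hV hT hT' hx, pushCurvature]

variable (hVc : HasCompactSupport V)
include hVc

/-- Material derivatives of the frame images and of the integrand. -/
theorem exists_hasMaterialDeriv {s : E3} (h : s ∈ frontier Ω) (hg : tvIntegrand Ω s ≠ 0)
    (ξ : OrthonormalBasis (Fin 2) ℝ (tangentPlane (frontier Ω) s)) :
    ∃ w : Fin 2 → E3,
      (∀ i, HasMaterialDerivNormalFrame Ω V s (fun j => (ξ j : E3)) i (w i)) ∧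
      HasMaterialDeriv tvIntegrand Ω V s
        (1 / tvIntegrand Ω s * ∑ i, ⟪normalDeriv Ω s (ξ i : E3), w i⟫) := by
  have hn0 : outerNormal Ω s ≠ 0 := fun h0 => by
    have := norm_outerNormal hΩ hs h
    rw [h0, norm_zero] at this; norm_num at this
  set ζ : Fin 2 → E3 := fun j => (ξ j : E3) with hζ
  have hζ0 : ‖ζ 0‖ = 1 := by rw [hζ, ← Submodule.coe_norm]; exact ξ.norm_eq_one 0
  have hζ1 : ‖ζ 1‖ = 1 := by rw [hζ, ← Submodule.coe_norm]; exact ξ.norm_eq_one 1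
  have hζ01 : ⟪ζ 0, ζ 1⟫ = 0 := by rw [hζ, ← Submodule.coe_inner]; exact ξ.inner_eq_zero (by decide)
  have hz0 : ζ 0 ≠ 0 := norm_ne_zero_iff.1 (by rw [hζ0]; norm_num)
  have hz1 : ζ 1 ≠ 0 := norm_ne_zero_iff.1 (by rw [hζ1]; norm_num)
  have hζt : ∀ i, ⟪outerNormal Ω s, ζ i⟫ = 0 := fun i =>
    (mem_tangentPlane_iff hΩ hs h _).1 (ξ i).2
  have hF0 : fderiv ℝ (perturb V 0) s = 1 := by
    rw [fderiv_perturb hV]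
    exact (congrArg (1 + ·) (zero_smul ℝ (fderiv ℝ V s))).trans (add_zero _)
  have hFc : ContDiff ℝ ∞ fun ε : ℝ => fderiv ℝ (perturb V ε) s := by
    simp only [fderiv_perturb hV]; fun_prop
  have hf1 : ContDiffAt ℝ ∞ (perturbedFrame₁ V s (ζ 0)) 0 := by
    refine ContDiffAt.comp (g := unitVec) (f := fun ε : ℝ => fderiv ℝ (perturb V ε) s (ζ 0)) 0 ?_ ?_
    · exact contDiffAt_unitVec (by simpa [hF0] using hz0)
    · exact hFc.contDiffAt.clm_apply contDiffAt_const
  have hf10 : perturbedFrame₁ V s (ζ 0) 0 = ζ 0 := by simp [perturbedFrame₁, hF0, hζ0]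
  set w₂ : ℝ → E3 := fun ε => fderiv ℝ (perturb V ε) s (ζ 1) -
    ⟪perturbedFrame₁ V s (ζ 0) ε, fderiv ℝ (perturb V ε) s (ζ 1)⟫ • perturbedFrame₁ V s (ζ 0) ε
    with hw₂
  have hw₂c : ContDiffAt ℝ ∞ w₂ 0 := by
    have h1 : ContDiffAt ℝ ∞ (fun ε : ℝ => fderiv ℝ (perturb V ε) s (ζ 1)) 0 :=
      hFc.contDiffAt.clm_apply contDiffAt_const
    exact h1.sub ((hf1.inner ℝ h1).smul hf1)
  have hw₂0 : w₂ 0 = ζ 1 := by simp [hw₂, hf10, hF0, hζ01]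
  have hf2 : ContDiffAt ℝ ∞ (perturbedFrame₂ V s (ζ 0) (ζ 1)) 0 :=
    ContDiffAt.comp (g := unitVec) (f := w₂) 0 (contDiffAt_unitVec (by rwa [hw₂0])) hw₂c
  have hf20 : perturbedFrame₂ V s (ζ 0) (ζ 1) 0 = ζ 1 := by
    change unitVec (w₂ 0) = _
    simp [hw₂0, unitVec, hζ1]
  have hfr : ∀ i, ContDiffAt ℝ ∞ (fun ε => perturbedFrame V s ζ ε i) 0 := by
    intro i; fin_cases i
    · exact hf1
    · exact hf2
  have hfr0 : ∀ i, perturbedFrame V s ζ 0 i = ζ i := by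
    intro i; fin_cases i
    · exact hf10
    · exact hf20
  set A : Fin 2 → ℝ → E3 := fun i ε => pushNormalDeriv (outerNormal Ω s) (normalDeriv Ω s)
    (1 + (ε • jet V s).1) (ε • jet V s).2 (perturbedFrame V s ζ ε i) with hA
  have hj : ContDiff ℝ ∞ fun ε : ℝ => ε • jet V s := contDiff_smul_vector _
  have hAd : ∀ i, DifferentiableAt ℝ (A i) 0 := by
    intro i
    refine (contDiffAt_pushNormalDeriv (n := fun _ : ℝ => outerNormal Ω s)
      (S := fun _ => normalDeriv Ω s) (F := fun ε : ℝ => 1 + (ε • jet V s).1)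
      (C := fun ε => (ε • jet V s).2) contDiffAt_const (hfr i) contDiffAt_const
      (contDiff_const.add hj.fst).contDiffAt hj.snd.contDiffAt
      (by rw [zero_smul_vector (jet V s)]; exact (add_zero (1 : E3 →L[ℝ] E3)).symm ▸ isUnit_one) hn0).differentiableAt (by simp)
  have hAeq : ∀ᶠ ε in 𝓝 (0 : ℝ), ∀ i, normalDeriv (perturbedDomain V Ω ε) (perturb V ε s)
      (perturbedFrame V s ζ ε i) = A i ε := by
    filter_upwards [eventually_exists_homeomorph_perturb hV hVc] with ε hε i
    obtain ⟨T, hT, -, hT', -⟩ := hε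
    exact normalDeriv_perturb hΩ hs hV hT hT' h _
  have hA0 : ∀ i, A i 0 = normalDeriv Ω s (ζ i) := by
    intro i
    rw [← hAeq.self_of_nhds i, hfr0]
    simp [perturbedDomain, show perturb V 0 = id from by ext1 x; simp [perturb]]
  have hw₂ev : ∀ᶠ ε in 𝓝 (0 : ℝ), w₂ ε ≠ 0 :=
    hw₂c.continuousAt.eventually_ne (by rwa [hw₂0])
  -- For small `ε` the Gram–Schmidt vectors form an orthonormal basis of the perturbed tangent
  -- plane, and the integrand may be computed in any such basis.
  have htv : ∀ᶠ ε in 𝓝 (0 : ℝ), tvIntegrand (perturbedDomain V Ω ε) (perturb V ε s) =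
      Real.sqrt (∑ i, ‖A i ε‖ ^ 2) := by
    filter_upwards [hAeq, eventually_exists_homeomorph_perturb hV hVc, hw₂ev] with ε h1 hε h2
    obtain ⟨T, hT, hTc, hT', -⟩ := hε
    have hs' := hs.image hTc hT'
    have hmem : T s ∈ frontier (T '' Ω) := by rw [← T.image_frontier]; exact ⟨s, h, rfl⟩
    have hF := isUnit_fderiv hTc hT' s
    have hΩ' := T.isOpenMap _ hΩ
    have htan : ∀ i, fderiv ℝ T s (ζ i) ∈ tangentPlane (frontier (T '' Ω)) (T s) := by
      intro i
      rw [mem_tangentPlane_iff hΩ' hs' hmem, outerNormal_image hTc hT' hΩ hs h,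
        inner_pushNormal_eq_zero_iff hF hn0]
      have : Ring.inverse (fderiv ℝ T s) (fderiv ℝ T s (ζ i)) = ζ i := by
        change (Ring.inverse (fderiv ℝ T s) * fderiv ℝ T s) (ζ i) = _
        rw [Ring.inverse_mul_cancel _ hF]; rfl
      rw [this, hζt]
    have hfin := finrank_tangentPlane hΩ' hs' hmem
    rw [hT] at htan hfin hmem
    have hne : fderiv ℝ (perturb V ε) s (ζ 0) ≠ 0 := fun h0 => hz0 (by
      have : Ring.inverse (fderiv ℝ T s) (fderiv ℝ T s (ζ 0)) = ζ 0 := by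
        change (Ring.inverse (fderiv ℝ T s) * fderiv ℝ T s) (ζ 0) = _
        rw [Ring.inverse_mul_cancel _ hF]; rfl
      rw [← this, hT, h0, map_zero])
    have hu1 : ‖perturbedFrame₁ V s (ζ 0) ε‖ = 1 := norm_unitVec hne
    have hv1 : ‖perturbedFrame₂ V s (ζ 0) (ζ 1) ε‖ = 1 := norm_unitVec h2
    have huW : perturbedFrame₁ V s (ζ 0) ε ∈ tangentPlane (frontier (perturb V ε '' Ω))
        (perturb V ε s) := Submodule.smul_mem _ _ (htan 0)
    have hvW : perturbedFrame₂ V s (ζ 0) (ζ 1) ε ∈ tangentPlane (frontier (perturb V ε '' Ω))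
        (perturb V ε s) :=
      Submodule.smul_mem _ _ (Submodule.sub_mem _ (htan 1) (Submodule.smul_mem _ _ huW))
    have huv : ⟪perturbedFrame₁ V s (ζ 0) ε, perturbedFrame₂ V s (ζ 0) (ζ 1) ε⟫ = 0 := by
      change ⟪perturbedFrame₁ V s (ζ 0) ε, ‖w₂ ε‖⁻¹ • w₂ ε⟫ = 0
      rw [inner_smul_right, hw₂]
      simp [inner_sub_right, inner_smul_right, hu1]
    obtain ⟨e, he0, he1⟩ := exists_orthonormalBasis_of_orthonormal hfin hu1 hv1 huv huW hvW
    rw [perturbedDomain, tvIntegrand_eq_basis _ _ e]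
    simp only [Fin.sum_univ_two, he0, he1]
    have h10 := h1 0
    have h11 := h1 1
    simp only [perturbedFrame, Matrix.cons_val_zero, Matrix.cons_val_one, perturbedDomain]
      at h10 h11
    rw [h10, h11]
  refine ⟨fun i => deriv (A i) 0, fun i => ?_, ?_⟩
  · exact (hAd i).hasDerivAt.congr_of_eventuallyEq (hAeq.mono fun ε hε => hε i)
  · have hg0 : tvIntegrand Ω s = Real.sqrt (∑ i, ‖A i 0‖ ^ 2) := by
      rw [← htv.self_of_nhds]
      simp [perturbedDomain, show perturb V 0 = id from by ext1 x; simp [perturb]]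
    have hd : HasDerivAt (fun ε => ∑ i, ‖A i ε‖ ^ 2) (∑ i, 2 * ⟪A i 0, deriv (A i) 0⟫) 0 :=
      HasDerivAt.fun_sum fun i _ => (hAd i).hasDerivAt.norm_sq
    -- Here `g ≠ 0` is needed: the square root is not differentiable at `0`.
    have hsq := hd.sqrt (fun h0 => hg (by rw [hg0, h0, Real.sqrt_zero]))
    refine (hsq.congr_of_eventuallyEq htv).congr_deriv ?_
    rw [← hg0, ← Finset.mul_sum]
    simp only [hA0]
    field_simp
    rfl

end Boundary

/-! ### Derivatives of integrals that depend on the field through its jet. -/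

section Superposition

variable {X J : Type*} [MeasurableSpace X] {μ : Measure X} [IsFiniteMeasure μ]
  [NormedAddCommGroup J] [NormedSpace ℝ J] {Φ : X → J → ℝ} {C r : ℝ}

theorem hasDerivAt_comp_smul {f : J → ℝ} (hf : DifferentiableAt ℝ f 0) (a : J) :
    HasDerivAt (fun ε : ℝ => f (ε • a)) (fderiv ℝ f 0 a) 0 := by
  have h : HasDerivAt (fun ε : ℝ => ε • a) a 0 := by
    simpa using (hasDerivAt_id (0 : ℝ)).smul_const a
  have hf' : HasFDerivAt f (fderiv ℝ f 0) ((0 : ℝ) • a) := by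
    rw [zero_smul]; exact hf.hasFDerivAt
  exact hf'.comp_hasDerivAt (0 : ℝ) h

/-- Differentiation under the integral sign along a line of bounded arguments. -/
theorem integrable_and_tendsto_superposition (hC : 0 ≤ C) (hr : 0 < r)
    (hdiff : ∀ᵐ x ∂μ, DifferentiableAt ℝ (Φ x) 0)
    (hlip : ∀ᵐ x ∂μ, ∀ j, ‖j‖ < r → |Φ x j - Φ x 0| ≤ C * ‖j‖)
    {a : X → J} {A : ℝ} (ha : ∀ x, ‖a x‖ ≤ A)
    (hmeas : ∀ᶠ ε in 𝓝 (0 : ℝ), AEStronglyMeasurable (fun x => Φ x (ε • a x)) μ)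
    (hint : Integrable (fun x => Φ x 0) μ) :
    Integrable (fun x => fderiv ℝ (Φ x) 0 (a x)) μ ∧
      Tendsto (fun ε => ((∫ x, Φ x (ε • a x) ∂μ) - ∫ x, Φ x 0 ∂μ) / ε) (𝓝[>] 0)
        (𝓝 (∫ x, fderiv ℝ (Φ x) 0 (a x) ∂μ)) := by
  have hsmall : ∀ᶠ ε : ℝ in 𝓝 0, |ε| * A < r := by
    have : Tendsto (fun ε : ℝ => |ε| * A) (𝓝 0) (𝓝 (|0| * A)) :=
      (continuous_abs.mul continuous_const).tendsto 0
    exact this.eventually_lt_const (by simpa using hr)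
  have h0 : ∀ x, Φ x ((0 : ℝ) • a x) = Φ x 0 := fun x => by rw [zero_smul]
  have h := integrable_and_tendsto_of_lipschitz (μ := μ) (f := fun ε x => Φ x (ε • a x))
    (f' := fun x => fderiv ℝ (Φ x) 0 (a x)) (C := C * A) hmeas (by simpa only [h0] using hint) ?_ ?_
  · simpa only [h0] using h
  · filter_upwards [hsmall] with ε hε
    filter_upwards [hlip] with x hx
    have hle : ‖ε • a x‖ ≤ |ε| * A := by
      rw [norm_smul, Real.norm_eq_abs]
      exact mul_le_mul_of_nonneg_left (ha x) (abs_nonneg ε)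
    rw [h0]
    calc |Φ x (ε • a x) - Φ x 0| ≤ C * ‖ε • a x‖ := hx _ (hle.trans_lt hε)
      _ ≤ C * (|ε| * A) := mul_le_mul_of_nonneg_left hle hC
      _ = C * A * |ε| := by ring
  · filter_upwards [hdiff] with x hx using hasDerivAt_comp_smul hx (a x)

/-- The integral of the pointwise derivative depends linearly and continuously on a parameter that
determines the direction linearly and continuously in the uniform norm. -/
theorem exists_clm_integral_fderiv (hC : 0 ≤ C) (hr : 0 < r)
    (hdiff : ∀ᵐ x ∂μ, DifferentiableAt ℝ (Φ x) 0)
    (hlip : ∀ᵐ x ∂μ, ∀ j, ‖j‖ < r → |Φ x j - Φ x 0| ≤ C * ‖j‖)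
    {E : Type*} [AddCommGroup E] [Module ℝ E] [TopologicalSpace E] [IsTopologicalAddGroup E]
    {a : E → X → J} (hadd : ∀ V W x, a (V + W) x = a V x + a W x)
    (hsmul : ∀ (c : ℝ) V x, a (c • V) x = c • a V x)
    {A : E → ℝ} (ha : ∀ V x, ‖a V x‖ ≤ A V) (hA : Tendsto A (𝓝 0) (𝓝 0))
    (hint : ∀ V, Integrable (fun x => fderiv ℝ (Φ x) 0 (a V x)) μ) :
    ∃ L : E →L[ℝ] ℝ, ∀ V, L V = ∫ x, fderiv ℝ (Φ x) 0 (a V x) ∂μ := by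
  let L : E →ₗ[ℝ] ℝ :=
    { toFun := fun V => ∫ x, fderiv ℝ (Φ x) 0 (a V x) ∂μ
      map_add' := fun V W => by
        rw [← integral_add (hint V) (hint W)]
        simp only [hadd, map_add]
      map_smul' := fun c V => by
        rw [RingHom.id_apply, ← integral_smul]
        simp only [hsmul, map_smul] }
  have hbound : ∀ V, ‖L V‖ ≤ C * A V * μ.real Set.univ := by
    intro V
    refine norm_integral_le_of_norm_le_const ?_
    filter_upwards [hdiff, hlip] with x hx hl
    -- The Lipschitz constant at `0` bounds the derivative there, uniformly in `x`. Continuity of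
    -- the linear functional then only has to be checked at the zero field.
    have hle : ‖fderiv ℝ (Φ x) 0‖ ≤ C := by
      refine hx.hasFDerivAt.le_of_lip' hC ?_
      filter_upwards [Metric.ball_mem_nhds (0 : J) hr] with j hj
      rw [sub_zero]
      exact hl j (by simpa using hj)
    exact (ContinuousLinearMap.le_opNorm _ _).trans
      (mul_le_mul hle (ha V x) (norm_nonneg _) hC)
  have hcont : ContinuousAt L 0 := by
    rw [ContinuousAt, map_zero]
    refine squeeze_zero_norm hbound ?_
    simpa using (hA.const_mul C).mul_const (μ.real Set.univ)
  exact ⟨⟨L, continuous_of_continuousAt_zero L hcont⟩, fun V => rfl⟩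

end Superposition

/-- The norms of the first two derivatives of test vector fields are continuous at zero. -/
theorem exists_jet_bound (D : Opens E3) : ∃ A : 𝓓(D, E3) → ℝ,
    (∀ (V : 𝓓(D, E3)) (x : E3), ‖jet V x‖ ≤ A V) ∧ Tendsto A (𝓝 0) (𝓝 0) := by
  let D₁ := TestFunction.fderivCLM (Ω := D) (F := E3) ℝ ⊤ ⊤
  let D₂ := TestFunction.fderivCLM (Ω := D) (F := E3 →L[ℝ] E3) ℝ ⊤ ⊤
  let B₁ := TestFunction.toBoundedContinuousFunctionCLM (Ω := D) (F := E3 →L[ℝ] E3) (n := ⊤) ℝ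
  let B₂ := TestFunction.toBoundedContinuousFunctionCLM (Ω := D) (F := E3 →L[ℝ] E3 →L[ℝ] E3)
    (n := ⊤) ℝ
  have h₁ : ∀ (V : 𝓓(D, E3)) (x : E3), B₁ (D₁ V) x = fderiv ℝ V x := fun V x => by
    change D₁ V x = _
    simp [D₁]
  have h₂ : ∀ (V : 𝓓(D, E3)) (x : E3), B₂ (D₂ (D₁ V)) x = fderiv ℝ (fderiv ℝ V) x := fun V x => by
    change D₂ (D₁ V) x = _
    simp [D₁, D₂]
  refine ⟨fun V => ‖B₁ (D₁ V)‖ + ‖B₂ (D₂ (D₁ V))‖, fun V x => ?_, ?_⟩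
  · rw [jet, ← h₁, ← h₂]
    refine (norm_prod_le_iff.2 ⟨?_, ?_⟩)
    · exact ((B₁ (D₁ V)).norm_coe_le_norm x).trans (le_add_of_nonneg_right (norm_nonneg _))
    · exact ((B₂ (D₂ (D₁ V))).norm_coe_le_norm x).trans (le_add_of_nonneg_left (norm_nonneg _))
  · have hc : Continuous fun V => ‖B₁ (D₁ V)‖ + ‖B₂ (D₂ (D₁ V))‖ :=
      (B₁.continuous.comp D₁.continuous).norm.add
        (B₂.continuous.comp (D₂.continuous.comp D₁.continuous)).norm
    simpa using hc.tendsto 0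

theorem jet_add {V W : E3 → E3} (hV : ContDiff ℝ ∞ V) (hW : ContDiff ℝ ∞ W) (x : E3) :
    jet (V + W) x = jet V x + jet W x := by
  have h : fderiv ℝ (V + W) = fderiv ℝ V + fderiv ℝ W := by
    ext1 x
    exact fderiv_add (hV.differentiable (by simp) x) (hW.differentiable (by simp) x)
  rw [jet, h, fderiv_add ((hV.fderiv_right (m := ∞) (by simp)).differentiable (by simp) x)
    ((hW.fderiv_right (m := ∞) (by simp)).differentiable (by simp) x)]
  rfl

theorem jet_smul {V : E3 → E3} (hV : ContDiff ℝ ∞ V) (c : ℝ) (x : E3) :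
    jet (c • V) x = c • jet V x := by
  have h : fderiv ℝ (c • V) = c • fderiv ℝ V := by
    ext1 x
    exact fderiv_const_smul (hV.differentiable (by simp) x) c
  rw [jet, h, fderiv_const_smul ((hV.fderiv_right (m := ∞) (by simp)).differentiable (by simp) x)]
  rfl

theorem perturb_zero (V : E3 → E3) : perturb V 0 = id := by
  ext1 x; simp [perturb]

theorem perturbedDomain_zero (V : E3 → E3) (Ω : Set E3) : perturbedDomain V Ω 0 = Ω := by
  simp [perturbedDomain, perturb_zero]

theorem frontier_perturbedDomain {V : E3 → E3} {Ω : Set E3} {ε : ℝ} {T : E3 ≃ₜ E3}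
    (hT : ⇑T = perturb V ε) : frontier (perturbedDomain V Ω ε) = perturb V ε '' frontier Ω := by
  rw [perturbedDomain, ← hT, T.image_frontier]

/-- Where the integrand vanishes, all principal curvatures vanish. -/
theorem tvIntegrand_ne_zero_of_isPrincipalCurvature {Ω : Set E3} {s : E3} {k : ℝ}
    (hk : IsPrincipalCurvature Ω s k) (hk0 : k ≠ 0) : tvIntegrand Ω s ≠ 0 := by
  intro h
  rw [tvIntegrand_eq, Real.sqrt_eq_zero (by positivity),
    Finset.sum_eq_zero_iff_of_nonneg (fun _ _ => by positivity)] at h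
  have h0 : normalDeriv Ω s = 0 := by
    have : (normalDeriv Ω s : E3 →ₗ[ℝ] E3) = 0 := stdB.toBasis.ext fun i => by
      simpa using h i (Finset.mem_univ i)
    ext1 x
    exact LinearMap.congr_fun this x
  obtain ⟨v, hv⟩ := hk.exists_hasEigenvector
  have hv1 := hv.apply_eq_smul
  have : shapeOperator Ω s v = 0 := by simp [shapeOperator, h0]
  rw [this] at hv1
  exact (smul_ne_zero hk0 hv.2) hv1.symm

/-- The pulled back integrand of the total variation of the perturbed normal. -/
def pushIntegrand (p : SurfaceData) (j : Jet) : PiLp 2 (fun _ : Fin 3 => E3) :=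
  pushArea p j • pushCurvature p j

/-- With the nonnegative Jacobian absorbed into the vector, the full pulled back integrand is again
the norm of a smooth map, so the same Lipschitz and differentiability arguments cover it. -/
theorem norm_pushIntegrand (p : SurfaceData) (j : Jet) :
    ‖pushIntegrand p j‖ = pushArea p j * ‖pushCurvature p j‖ := by
  rw [pushIntegrand, norm_smul, Real.norm_of_nonneg (pushArea_nonneg p j)]

/-! ### Integrability and the pull-back of the functional to the original boundary. -/

section Boundary

variable {Ω : Set E3} (hΩ : IsOpen Ω) (hs : HasSmoothBoundary Ω)
include hΩ hs

theorem continuousOn_tvIntegrand : ContinuousOn (tvIntegrand Ω) (frontier Ω) := by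
  have : tvIntegrand Ω = fun s => Real.sqrt (∑ j, ‖normalDeriv Ω s (stdB j)‖ ^ 2) :=
    funext (tvIntegrand_eq Ω)
  rw [this]
  refine Real.continuous_sqrt.comp_continuousOn (continuousOn_finsetSum _ fun j _ => ?_)
  exact ((continuousOn_normalDeriv hΩ hs).clm_apply continuousOn_const).norm.pow 2

theorem hasTangentFrames_frontier : HasTangentFrames (frontier Ω) := by
  obtain ⟨u, v, huv⟩ := exists_frame hΩ hs
  intro s h
  obtain ⟨h1, h2, h3, h4, h5, -⟩ := huv s h
  exact ⟨u s, v s, isTangentFrame_of_orthonormal hΩ hs h h1 h2 h3 h4 h5⟩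

theorem integrableOn_tvIntegrand (hc : IsCompact (frontier Ω)) :
    IntegrableOn (tvIntegrand Ω) (frontier Ω) μHE[2] := by
  have hfin : IsFiniteMeasure (μHE[2].restrict (frontier Ω) : Measure E3) :=
    ⟨by simpa using (hasTangentFrames_frontier hΩ hs).measure_lt_top hc⟩
  have hcont := continuousOn_tvIntegrand hΩ hs
  obtain ⟨C, hC⟩ := hc.exists_bound_of_continuousOn hcont
  exact Integrable.of_bound (hcont.aestronglyMeasurable hc.measurableSet) C
    ((ae_restrict_iff' hc.measurableSet).2 (Eventually.of_forall hC))

theorem exists_dataSet (hc : IsCompact (frontier Ω)) {u v : E3 → E3}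
    (huv : ∀ x ∈ frontier Ω, ‖u x‖ = 1 ∧ ‖v x‖ = 1 ∧ ⟪u x, v x⟫ = 0) :
    ∃ M, ∀ x ∈ frontier Ω, (outerNormal Ω x, normalDeriv Ω x, u x, v x) ∈ dataSet M := by
  obtain ⟨M, hM⟩ := hc.exists_bound_of_continuousOn (continuousOn_normalDeriv hΩ hs)
  exact ⟨M, fun x hx => ⟨norm_outerNormal hΩ hs hx, hM x hx, (huv x hx).1, (huv x hx).2.1,
    (huv x hx).2.2⟩⟩

theorem norm_pushCurvature_zero {x : E3} (hx : x ∈ frontier Ω) (u v : E3) :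
    ‖pushCurvature (outerNormal Ω x, normalDeriv Ω x, u, v) 0‖ = tvIntegrand Ω x := by
  have hV : ContDiff ℝ ∞ (fun _ : E3 => (0 : E3)) := contDiff_const
  have h := tvIntegrand_perturb hΩ hs hV (ε := 0) (T := Homeomorph.refl E3)
    (by rw [perturb_zero]; rfl) contDiff_id hx u v
  rw [perturbedDomain_zero, perturb_zero, zero_smul_vector (jet (fun _ : E3 => (0 : E3)) x)] at h
  exact h.symm

variable {V : E3 → E3} (hV : ContDiff ℝ ∞ V)
include hV

/-- The total variation of the normal of a perturbed domain as an integral over the original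
boundary. -/
theorem totalVariationNormal_perturbedDomain (hc : IsCompact (frontier Ω)) {u v : E3 → E3}
    (huv : ∀ x ∈ frontier Ω, IsTangentFrame (frontier Ω) x (u x) (v x))
    {ε : ℝ} {T : E3 ≃ₜ E3} (hT : ⇑T = perturb V ε) (hT' : ContDiff ℝ ∞ T.symm) {K : NNReal}
    (hTK : LipschitzWith K T) :
    AEStronglyMeasurable (fun x => ‖pushCurvature (outerNormal Ω x, normalDeriv Ω x, u x, v x)
        (ε • jet V x)‖) (μHE[2].restrict (frontier Ω)) ∧
      AEStronglyMeasurable (fun x => ‖pushIntegrand (outerNormal Ω x, normalDeriv Ω x, u x, v x)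
        (ε • jet V x)‖) (μHE[2].restrict (frontier Ω)) ∧
      totalVariationNormal (perturbedDomain V Ω ε) = ∫ x in frontier Ω,
        ‖pushIntegrand (outerNormal Ω x, normalDeriv Ω x, u x, v x) (ε • jet V x)‖ ∂μHE[2] := by
  have hTc : ContDiff ℝ ∞ T := hT ▸ contDiff_perturb hV ε
  have hmeasΓ := hc.measurableSet
  obtain ⟨hm, hint⟩ := setIntegral_image_eq hc T hTK (F := fun x => 1 + (ε • jet V x).1)
    (fun x _ => by
      have h1 : HasFDerivAt T (1 + (ε • jet V x).1) x := hT ▸ hasFDerivAt_perturb hV ε x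
      exact hTc.contDiffAt.hasStrictFDerivAt' h1 (by simp))
    (fun x _ => by
      have h2 := isUnit_fderiv hTc hT' x
      rw [hT, fderiv_perturb hV] at h2
      exact (ContinuousLinearMap.isUnit_iff_bijective.1 h2).1) huv
    (tvIntegrand (perturbedDomain V Ω ε))
  have hcurv : Set.EqOn (fun x => tvIntegrand (perturbedDomain V Ω ε) (T x))
      (fun x => ‖pushCurvature (outerNormal Ω x, normalDeriv Ω x, u x, v x) (ε • jet V x)‖)
      (frontier Ω) := fun x hx => by
    change tvIntegrand (perturbedDomain V Ω ε) (T x) = _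
    rw [hT]
    exact tvIntegrand_perturb hΩ hs hV hT hT' hx (u x) (v x)
  -- Measurability of the curvature factor comes from continuity of the integrand on the image
  -- surface; that of the Jacobian comes from the area formula.
  have hcont : ContinuousOn (fun x => tvIntegrand (perturbedDomain V Ω ε) (T x)) (frontier Ω) := by
    have h1 : ContinuousOn (tvIntegrand (T '' Ω)) (frontier (T '' Ω)) :=
      continuousOn_tvIntegrand (T.isOpenMap _ hΩ) (hs.image hTc hT')
    rw [perturbedDomain, ← hT]
    refine h1.comp T.continuous.continuousOn fun x hx => ?_
    rw [← T.image_frontier]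
    exact ⟨x, hx, rfl⟩
  have hcm := (hcont.congr fun x hx => (hcurv hx).symm).aestronglyMeasurable
    (μ := (μHE[2] : Measure E3)) hmeasΓ
  refine ⟨hcm, ?_, ?_⟩
  · simp only [norm_pushIntegrand]
    exact hm.aestronglyMeasurable.mul hcm
  · rw [totalVariationNormal, frontier_perturbedDomain hT, ← hT, hint]
    refine setIntegral_congr_fun hmeasΓ fun x hx => ?_
    have h : tvIntegrand (perturbedDomain V Ω ε) (T x) =
      ‖pushCurvature (outerNormal Ω x, normalDeriv Ω x, u x, v x) (ε • jet V x)‖ := hcurv hx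
    rw [norm_pushIntegrand, ← h]
    rfl

end Boundary

section Norm

variable {P J Y : Type*} [NormedAddCommGroup P] [NormedSpace ℝ P] [NormedAddCommGroup J]
  [NormedSpace ℝ J] [NormedAddCommGroup Y] [InnerProductSpace ℝ Y] {f : P → J → Y}

/-- The norm is `1`-Lipschitz, so the uniform bound needs no nonvanishing of `f` and persists near
flat points. -/
theorem exists_uniform_lipschitz_norm {K : Set P} (hK : IsCompact K)
    (hf : ∀ p ∈ K, ContDiffAt ℝ ∞ (Function.uncurry f) (p, 0)) :
    ∃ C : ℝ, 0 ≤ C ∧ ∃ r > 0, ∀ p ∈ K, ∀ j, ‖j‖ < r → |‖f p j‖ - ‖f p 0‖| ≤ C * ‖j‖ := by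
  obtain ⟨C, hC, r, hr, h⟩ := exists_uniform_lipschitz hK fun p hp => (hf p hp).of_le (by simp)
  exact ⟨C, hC, r, hr, fun p hp j hj => (abs_norm_sub_norm_le _ _).trans (h p hp j hj)⟩

theorem differentiableAt_norm_of_uncurry {p : P}
    (hf : ContDiffAt ℝ ∞ (Function.uncurry f) (p, 0)) (h0 : f p 0 ≠ 0) :
    DifferentiableAt ℝ (fun j => ‖f p j‖) 0 := by
  have h1 : ContDiffAt ℝ ∞ (fun j => f p j) 0 :=
    ContDiffAt.comp (g := Function.uncurry f) (f := fun j => (p, j)) 0 hf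
      (contDiffAt_const.prodMk contDiffAt_id)
  exact (h1.norm ℝ h0).differentiableAt (by simp)

end Norm

theorem contDiffAt_pushCurvature_of_mem {M : ℝ} {p : SurfaceData} (hp : p ∈ dataSet M) :
    ContDiffAt ℝ ∞ (Function.uncurry pushCurvature) (p, 0) :=
  contDiffAt_pushCurvature (norm_ne_zero_iff.1 (by rw [hp.1]; norm_num))

theorem contDiffAt_pushIntegrand {M : ℝ} {p : SurfaceData} (hp : p ∈ dataSet M) :
    ContDiffAt ℝ ∞ (Function.uncurry pushIntegrand) (p, 0) :=
  (contDiffAt_pushArea hp.2.2.1 hp.2.2.2.1 hp.2.2.2.2).smul (contDiffAt_pushCurvature_of_mem hp)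

theorem norm_pushIntegrand_zero {M : ℝ} {p : SurfaceData} (hp : p ∈ dataSet M) :
    ‖pushIntegrand p 0‖ = ‖pushCurvature p 0‖ := by
  rw [norm_pushIntegrand, pushArea_zero hp.2.2.1 hp.2.2.2.1 hp.2.2.2.2, one_mul]

/-- The product rule for the pulled back integrand. -/
theorem fderiv_norm_pushIntegrand {M : ℝ} {p : SurfaceData} (hp : p ∈ dataSet M)
    (h0 : pushCurvature p 0 ≠ 0) (j : Jet) :
    fderiv ℝ (fun j => ‖pushIntegrand p j‖) 0 j =
      ‖pushCurvature p 0‖ * (⟪p.2.2.1, j.1 p.2.2.1⟫ + ⟪p.2.2.2, j.1 p.2.2.2⟫) +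
        fderiv ℝ (fun j => ‖pushCurvature p j‖) 0 j := by
  have h0' : pushIntegrand p 0 ≠ 0 := by
    rw [← norm_ne_zero_iff, norm_pushIntegrand_zero hp]; exact norm_ne_zero_iff.2 h0
  have hI := hasDerivAt_comp_smul
    (differentiableAt_norm_of_uncurry (contDiffAt_pushIntegrand hp) h0') j
  have hB := hasDerivAt_comp_smul
    (differentiableAt_norm_of_uncurry (contDiffAt_pushCurvature_of_mem hp) h0) j
  have hA := hasDerivAt_pushArea hp.2.2.1 hp.2.2.2.1 hp.2.2.2.2 j
  have hAB := hA.fun_mul hB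
  simp only [norm_pushIntegrand] at hI ⊢
  rw [hI.unique hAB, zero_smul_vector j, pushArea_zero hp.2.2.1 hp.2.2.2.1 hp.2.2.2.2]
  ring

/-! ### Shape differentiability. -/

section Boundary

variable {Ω : Set E3} (hΩ : IsOpen Ω) (hs : HasSmoothBoundary Ω)
include hΩ hs

theorem materialDeriv_tvIntegrand {V : E3 → E3} (hV : ContDiff ℝ ∞ V) (hVc : HasCompactSupport V)
    {x : E3} (hx : x ∈ frontier Ω) (u v : E3)
    (hd : DifferentiableAt ℝ
      (fun j => ‖pushCurvature (outerNormal Ω x, normalDeriv Ω x, u, v) j‖) 0) :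
    materialDeriv tvIntegrand Ω V x =
      fderiv ℝ (fun j => ‖pushCurvature (outerNormal Ω x, normalDeriv Ω x, u, v) j‖) 0
        (jet V x) := by
  refine HasDerivAt.deriv ((hasDerivAt_comp_smul hd (jet V x)).congr_of_eventuallyEq ?_)
  filter_upwards [eventually_exists_homeomorph_perturb hV hVc] with ε hε
  obtain ⟨T, hT, -, hT', -⟩ := hε
  exact tvIntegrand_perturb hΩ hs hV hT hT' hx u v

/-- The total variation of the normal is shape differentiable if the second fundamental form
vanishes almost nowhere. -/
theorem shapeDifferentiable_totalVariationNormal (hc : IsCompact (frontier Ω))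
    (hne : ∀ᵐ x ∂(μHE[2] : Measure E3).restrict (frontier Ω), tvIntegrand Ω x ≠ 0) (D : Opens E3) :
    ShapeDifferentiable totalVariationNormal D Ω ∧ ∀ V : 𝓓(D, E3),
      IntegrableOn (materialDeriv tvIntegrand Ω V) (frontier Ω) μHE[2] ∧
      HasShapeDeriv totalVariationNormal Ω V
        (∫ s in frontier Ω, (tvIntegrand Ω s * tangentialDiv (frontier Ω) V s
          + materialDeriv tvIntegrand Ω V s) ∂μHE[2]) := by
  obtain ⟨u, v, huv⟩ := exists_frame hΩ hs
  have hfr : ∀ x ∈ frontier Ω, IsTangentFrame (frontier Ω) x (u x) (v x) := fun x hx => by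
    obtain ⟨h1, h2, h3, h4, h5, -⟩ := huv x hx
    exact isTangentFrame_of_orthonormal hΩ hs hx h1 h2 h3 h4 h5
  obtain ⟨M, hM⟩ := exists_dataSet hΩ hs hc fun x hx =>
    ⟨(huv x hx).1, (huv x hx).2.1, (huv x hx).2.2.1⟩
  have hmeasΓ := hc.measurableSet
  have hfin : IsFiniteMeasure (μHE[2].restrict (frontier Ω) : Measure E3) :=
    ⟨by simpa using (hasTangentFrames_frontier hΩ hs).measure_lt_top hc⟩
  set μ : Measure E3 := μHE[2].restrict (frontier Ω) with hμ
  set p : E3 → SurfaceData := fun x => (outerNormal Ω x, normalDeriv Ω x, u x, v x) with hp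
  have hae : ∀ᵐ x ∂μ, x ∈ frontier Ω := ae_restrict_mem hmeasΓ
  have hpc : ∀ x ∈ frontier Ω, ‖pushCurvature (p x) 0‖ = tvIntegrand Ω x := fun x hx =>
    norm_pushCurvature_zero hΩ hs hx _ _
  have hne' : ∀ᵐ x ∂μ, pushCurvature (p x) 0 ≠ 0 := by
    filter_upwards [hae, hne] with x hx h0
    rwa [← norm_ne_zero_iff, hpc x hx]
  have hcurv : ∀ᵐ x ∂μ, DifferentiableAt ℝ (fun j => ‖pushCurvature (p x) j‖) 0 := by
    filter_upwards [hae, hne'] with x hx h0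
    exact differentiableAt_norm_of_uncurry (contDiffAt_pushCurvature_of_mem (hM x hx)) h0
  have hintg : ∀ᵐ x ∂μ, DifferentiableAt ℝ (fun j => ‖pushIntegrand (p x) j‖) 0 := by
    filter_upwards [hae, hne'] with x hx h0
    refine differentiableAt_norm_of_uncurry (contDiffAt_pushIntegrand (hM x hx)) ?_
    rwa [← norm_ne_zero_iff, norm_pushIntegrand_zero (hM x hx), norm_ne_zero_iff]
  obtain ⟨C₁, hC₁, r₁, hr₁, hl₁⟩ := exists_uniform_lipschitz_norm (isCompact_dataSet M)
    fun p hp => contDiffAt_pushCurvature_of_mem hp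
  obtain ⟨C₂, hC₂, r₂, hr₂, hl₂⟩ := exists_uniform_lipschitz_norm (isCompact_dataSet M)
    fun p hp => contDiffAt_pushIntegrand hp
  have hlip₁ : ∀ᵐ x ∂μ, ∀ j, ‖j‖ < r₁ →
      |‖pushCurvature (p x) j‖ - ‖pushCurvature (p x) 0‖| ≤ C₁ * ‖j‖ :=
    hae.mono fun x hx => hl₁ _ (hM x hx)
  have hlip₂ : ∀ᵐ x ∂μ, ∀ j, ‖j‖ < r₂ →
      |‖pushIntegrand (p x) j‖ - ‖pushIntegrand (p x) 0‖| ≤ C₂ * ‖j‖ :=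
    hae.mono fun x hx => hl₂ _ (hM x hx)
  have hint := integrableOn_tvIntegrand hΩ hs hc
  have hint₁ : Integrable (fun x => ‖pushCurvature (p x) 0‖) μ :=
    Integrable.congr hint (hae.mono fun x hx => (hpc x hx).symm)
  have hint₂ : Integrable (fun x => ‖pushIntegrand (p x) 0‖) μ :=
    Integrable.congr hint₁ (hae.mono fun x hx => (norm_pushIntegrand_zero (hM x hx)).symm)
  have hJ0 : totalVariationNormal Ω = ∫ x, ‖pushIntegrand (p x) 0‖ ∂μ :=
    integral_congr_ae (hae.mono fun x hx =>
      ((norm_pushIntegrand_zero (hM x hx)).trans (hpc x hx)).symm)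
  obtain ⟨A, hjA, hA⟩ := exists_jet_bound D
  have hsm : ∀ V : 𝓓(D, E3), ContDiff ℝ ∞ V := fun V => V.contDiff
  have hev : ∀ V : 𝓓(D, E3), ∀ᶠ ε in 𝓝 (0 : ℝ),
      AEStronglyMeasurable (fun x => ‖pushCurvature (p x) (ε • jet V x)‖) μ ∧
      AEStronglyMeasurable (fun x => ‖pushIntegrand (p x) (ε • jet V x)‖) μ ∧
      totalVariationNormal (perturbedDomain V Ω ε) =
        ∫ x, ‖pushIntegrand (p x) (ε • jet V x)‖ ∂μ := by
    intro V
    filter_upwards [eventually_exists_homeomorph_perturb (hsm V) V.hasCompactSupport] with ε hε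
    obtain ⟨T, hT, -, hT', hTK⟩ := hε
    exact totalVariationNormal_perturbedDomain hΩ hs (hsm V) hc hfr hT hT' hTK
  -- The superposition lemma is applied twice: without the Jacobian it gives integrability of the
  -- material derivative, with it the shape derivative.
  have hvar₁ := fun V : 𝓓(D, E3) => integrable_and_tendsto_superposition hC₁ hr₁ hcurv hlip₁
    (hjA V) ((hev V).mono fun ε hε => hε.1) hint₁
  have hvar₂ := fun V : 𝓓(D, E3) => integrable_and_tendsto_superposition hC₂ hr₂ hintg hlip₂
    (hjA V) ((hev V).mono fun ε hε => hε.2.1) hint₂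
  have hderiv : ∀ V : 𝓓(D, E3), HasShapeDeriv totalVariationNormal Ω V
      (∫ x, fderiv ℝ (fun j => ‖pushIntegrand (p x) j‖) 0 (jet V x) ∂μ) := by
    intro V
    refine (hvar₂ V).2.congr' ?_
    filter_upwards [nhdsWithin_le_nhds (hev V)] with ε hε
    rw [hε.2.2, hJ0]
  have hmat : ∀ V : 𝓓(D, E3), ∀ᵐ x ∂μ, materialDeriv tvIntegrand Ω V x =
      fderiv ℝ (fun j => ‖pushCurvature (p x) j‖) 0 (jet V x) := by
    intro V
    filter_upwards [hae, hcurv] with x hx hd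
    exact materialDeriv_tvIntegrand hΩ hs (hsm V) V.hasCompactSupport hx _ _ hd
  refine ⟨?_, fun V => ⟨?_, ?_⟩⟩
  · obtain ⟨L, hL⟩ := exists_clm_integral_fderiv hC₂ hr₂ hintg hlip₂
      (a := fun (V : 𝓓(D, E3)) x => jet V x)
      (fun V W x => jet_add (hsm V) (hsm W) x) (fun c V x => jet_smul (hsm V) c x) hjA hA
      (fun V => (hvar₂ V).1)
    exact ⟨L, fun V => hL V ▸ hderiv V⟩
  · exact Integrable.congr (hvar₁ V).1 ((hmat V).mono fun x hx => hx.symm)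
  -- The two integrands agree almost everywhere by the product rule, the Jacobian contributing `g
  -- div_Γ V`.
  · convert hderiv V using 1
    refine integral_congr_ae ?_
    filter_upwards [hae, hne', hmat V] with x hx h0 hm
    rw [fderiv_norm_pushIntegrand (hM x hx) h0, hpc x hx, hm, (huv x hx).2.2.2.2.2 V]
    rfl

end Boundary

end ShapeTV

end

/-! ### The main theorem. -/

open ShapeTV

theorem mainTheorem2 (Ω : Set E3) (hΩ : IsOpen Ω) (hΩb : Bornology.IsBounded Ω)
    (hΩs : HasSmoothBoundary Ω) (D : TopologicalSpace.Opens E3)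
    (hD : Ω ⊆ (D : Set E3))
    (hcurv : (μHE[2] : MeasureTheory.Measure E3)
      {s ∈ frontier Ω | ∀ k : ℝ, IsPrincipalCurvature Ω s k → k = 0} = 0) :
    ShapeDifferentiable totalVariationNormal D Ω ∧
    ∀ V : 𝓓(D, E3),
      (∀ᶠ ε in 𝓝 (0 : ℝ), IntegrableOn (tvIntegrand (perturbedDomain V Ω ε))
        (frontier (perturbedDomain V Ω ε)) μHE[2]) ∧
      (∀ s ∈ frontier Ω, (∃ k : ℝ, IsPrincipalCurvature Ω s k ∧ k ≠ 0) →
        ∀ ξ : OrthonormalBasis (Fin 2) ℝ (tangentPlane (frontier Ω) s),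
          ∃ w : Fin 2 → E3,
            (∀ i, HasMaterialDerivNormalFrame Ω V s (fun j => (ξ j : E3)) i (w i)) ∧
            HasMaterialDeriv tvIntegrand Ω V s
              (1 / tvIntegrand Ω s *
                ∑ i, ⟪normalDeriv Ω s (ξ i : E3), w i⟫)) ∧
      IntegrableOn (materialDeriv tvIntegrand Ω V) (frontier Ω) μHE[2] ∧
      HasShapeDeriv totalVariationNormal Ω V
        (∫ s in frontier Ω, (tvIntegrand Ω s * tangentialDiv (frontier Ω) V s
          + materialDeriv tvIntegrand Ω V s) ∂μHE[2]) := by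
  have hc : IsCompact (frontier Ω) := Metric.isCompact_of_isClosed_isBounded isClosed_frontier
    (hΩb.closure.subset frontier_subset_closure)
  have hne : ∀ᵐ x ∂(μHE[2] : Measure E3).restrict (frontier Ω), tvIntegrand Ω x ≠ 0 := by
    filter_upwards [ae_restrict_mem hc.measurableSet,
      ae_restrict_of_ae (measure_eq_zero_iff_ae_notMem.1 hcurv)] with x hx hk
    simp only [not_and, not_forall] at hk
    obtain ⟨k, hk1, hk2⟩ := hk hx
    exact tvIntegrand_ne_zero_of_isPrincipalCurvature hk1 hk2
  obtain ⟨hdiff, hvar⟩ := shapeDifferentiable_totalVariationNormal hΩ hΩs hc hne D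
  refine ⟨hdiff, fun V => ⟨?_, ?_, hvar V⟩⟩
  · filter_upwards [eventually_exists_homeomorph_perturb V.contDiff V.hasCompactSupport] with ε hε
    obtain ⟨T, hT, hTc, hT', -⟩ := hε
    rw [perturbedDomain, ← hT]
    refine integrableOn_tvIntegrand (T.isOpenMap _ hΩ) (hΩs.image hTc hT') ?_
    rw [← T.image_frontier]
    exact hc.image T.continuous
  · rintro s hs ⟨k, hk, hk0⟩ ξ
    exact exists_hasMaterialDeriv hΩ hΩs V.contDiff V.hasCompactSupport hs
      (tvIntegrand_ne_zero_of_isPrincipalCurvature hk hk0) ξ
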